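/- Let $p$ be an odd prime and let $K/\mathbb{Q}$ be a Galois extension of degree $p$ with Galois group $G=\langle\sigma\rangle$. Let $Cl_K$ be the ideal class group of $K$, $Cl_K[p]$ its $p$-torsion subgroup, and let $\varphi=1-\sigma$, i.e. $\varphi(c)=c/\sigma(c)$ for $c\in Cl_K$. Let $\ker\varphi^2$ denote the kernel of $\varphi^2$ on $Cl_K[p]$, and put $\operatorname{im}\varphi=\varphi(\ker\varphi^2)$. Write $N$ for the norm from $K$ to $\mathbb{Q}$, on elements and on fractional ideals (the norm of a nonzero ideal being a positive rational number). Let $D_K$ be the discriminant of $K$, and put $D=D_K$ if $p\nmid D_K$ and $D=D_K/p^{p-1}$ if $p\mid D_K$. Then: (i) for every nonzero fractional ideal $\mathfrak{b}$ of $K$ whose class is fixed by $G$, the class of $\mathfrak{b}$ lies in $\operatorname{im}\varphi$ if and only if $N\mathfrak{b}=N(\alpha)$ for some $\alpha\in K$; (ii) $$\left|\varphi(\ker\varphi^2)\right|=\frac1p\,\#\left\{\,b\in\mathbb{Z}_{\ge1}\;:\; b\mid D,\ b=N(\alpha)\text{ for some }\alpha\in K^\times\right\}.$$ -/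

import Mathlib

open scoped NumberField nonZeroDivisors

namespace CyclicDegP

variable {K : Type*} [Field K] [NumberField K]

/-- The action of a field automorphism `σ` of `K` on the ideal class group of `K`,
`[I] ↦ [σ(I)]`. -/
noncomputable def classAct (σ : K ≃ₐ[ℚ] K) : ClassGroup (𝓞 K) →* ClassGroup (𝓞 K) :=
  (ClassGroup.mulEquiv
    (NumberField.RingOfIntegers.mapRingEquiv (σ : K ≃+* K))).toMonoidHom

/-- The endomorphism `φ = 1 - σ` of the class group, written multiplicatively:
`c ↦ c / σ(c)`. -/
noncomputable def phi (σ : K ≃ₐ[ℚ] K) : ClassGroup (𝓞 K) →* ClassGroup (𝓞 K) :=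
  MonoidHom.id (ClassGroup (𝓞 K)) / classAct σ

/-- The kernel of `φ²` acting on the `p`-torsion `Cl_K[p]` of the class group. -/
noncomputable def kerPhiSq (p : ℕ) (σ : K ≃ₐ[ℚ] K) : Subgroup (ClassGroup (𝓞 K)) :=
  (powMonoidHom p : ClassGroup (𝓞 K) →* ClassGroup (𝓞 K)).ker ⊓ ((phi σ).comp (phi σ)).ker

/-- `im φ = φ(ker φ²)`. -/
noncomputable def imPhi (p : ℕ) (σ : K ≃ₐ[ℚ] K) : Subgroup (ClassGroup (𝓞 K)) :=
  (kerPhiSq p σ).map (phi σ)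

/-- `D = D_K` if `p ∤ D_K`, and `D = D_K / p ^ (p - 1)` if `p ∣ D_K`. For `K` cyclic over `ℚ` of
odd prime degree `p` the division is exact and `D` is the `(p - 1)`-st power of the product of the
primes ramified in `K`. -/
noncomputable def normDisc (p : ℕ) (K : Type*) [Field K] [NumberField K] : ℤ :=
  if (p : ℤ) ∣ NumberField.discr K then NumberField.discr K / (p : ℤ) ^ (p - 1)
  else NumberField.discr K

end CyclicDegP

/-! Part (i) rests on Hilbert 90 for ideals: primes above the same rational prime are conjugate, so
an ideal of norm 1 has the form C/σC. If [J] = φ([C]), then J = (x)·C/σC and NJ = N(±x), the sign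
being free in odd degree. Conversely NJ = N(x) gives J/(x) = C/σC, so [J] = φ([C]) and φ²([C]) = 1;
for odd p this already forces [C]^p = 1.

For (ii), Hilbert 90 for elements puts a fixed ideal in every fixed class. Consider the chain:
rational ideals ≤ fixed principal ideals ≤ `fixedNormIdeals`. The upper index is |im φ| by (i). The
lower index is p (`relIndex_range_ratIdeal`): x ↦ x/σx turns it into the index of (1-σ)E in the
norm-one units, where E is the unit group. These form a lattice of rank p-1 killed by 1+σ+…+σ^(p-1),
on which det(1-σ) = Φ_p(1) = p.

The total index is the count in (ii) (`ncard_eq_relIndex`). A fixed ideal satisfies J^p = (NJ), so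
it is determined by its norm, and each coset of the rational ideals contains exactly one ideal whose
norm is a p-th-power-free integer, necessarily supported at ramified primes. The p-th-power-free
integers so supported are the divisors of D, because |D| is the (p-1)-st power of the product of the
ramified primes. That follows from the different, computed with an Eisenstein uniformizer at each
ramified prime. -/

namespace CyclicDegP

/-! ### Galois action and norms on fractional ideals; Hilbert 90 for ideals -/

section General

variable {R S K L : Type*} [CommRing R] [IsDomain R] [CommRing S] [IsDomain S] [Field K] [Field L]
  [Algebra R K] [IsFractionRing R K] [Algebra S L] [IsFractionRing S L]

lemma ringEquivOfRingEquiv_coeIdeal (g : R ≃+* S) (I : Ideal R) :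
    FractionalIdeal.ringEquivOfRingEquiv K L g (I : FractionalIdeal R⁰ K) =
      ((I.map (g : R →+* S) : Ideal S) : FractionalIdeal S⁰ L) := by
  apply FractionalIdeal.coeToSubmodule_injective
  ext x
  change x ∈ (FractionalIdeal.ringEquivOfRingEquiv K L g (I : FractionalIdeal R⁰ K)).val ↔
    x ∈ IsLocalization.coeSubmodule L _
  constructor
  · rintro ⟨_, ⟨y, hy, rfl⟩, rfl⟩
    exact ⟨g y, Ideal.mem_map_of_mem _ hy,
      (IsFractionRing.ringEquivOfRingEquiv_algebraMap (K := K) (L := L) g y).symm⟩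
  · rintro ⟨_, hz, rfl⟩
    obtain ⟨y, hy, rfl⟩ := (Ideal.mem_map_iff_of_surjective (g : R →+* S) g.surjective).1 hz
    exact ⟨_, ⟨y, hy, rfl⟩, IsFractionRing.ringEquivOfRingEquiv_algebraMap (K := K) (L := L) g y⟩

end General

lemma mulEquiv_mk0 {R S : Type*} [CommRing R] [IsDedekindDomain R] [CommRing S]
    [IsDedekindDomain S] (g : R ≃+* S) (I : (Ideal R)⁰)
    (J : (Ideal S)⁰) (hJ : (J : Ideal S) = (I : Ideal R).map (g : R →+* S)) :
    ClassGroup.mulEquiv g (ClassGroup.mk0 I) = ClassGroup.mk0 J := by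
  rw [ClassGroup.mulEquiv, MulEquiv.trans_apply, ClassGroup.equiv_mk0, MulEquiv.trans_apply,
    MulEquiv.symm_apply_eq, ClassGroup.equiv_mk0]
  refine congrArg (QuotientGroup.mk' _) ?_
  ext1
  simp [hJ, ringEquivOfRingEquiv_coeIdeal]

variable {K : Type*} [Field K] [NumberField K]

/-- The action of a field automorphism on the group of nonzero fractional ideals. -/
noncomputable def idealAct (σ : K ≃ₐ[ℚ] K) :
    (FractionalIdeal (𝓞 K)⁰ K)ˣ →* (FractionalIdeal (𝓞 K)⁰ K)ˣ :=
  (Units.mapEquiv (FractionalIdeal.ringEquivOfRingEquiv K K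
    (NumberField.RingOfIntegers.mapRingEquiv (σ : K ≃+* K))).toMulEquiv).toMonoidHom

lemma coe_idealAct (σ : K ≃ₐ[ℚ] K) (J : (FractionalIdeal (𝓞 K)⁰ K)ˣ) :
    (idealAct σ J : FractionalIdeal (𝓞 K)⁰ K) = FractionalIdeal.ringEquivOfRingEquiv K K
      (NumberField.RingOfIntegers.mapRingEquiv (σ : K ≃+* K)) J := rfl

lemma idealAct_toPrincipalIdeal (σ : K ≃ₐ[ℚ] K) (x : Kˣ) :
    idealAct σ (toPrincipalIdeal (𝓞 K) K x) =
      toPrincipalIdeal (𝓞 K) K (Units.map (σ : K →* K) x) := by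
  ext1
  have h : ((IsFractionRing.ringEquivOfRingEquiv (K := K) (L := K)
      (NumberField.RingOfIntegers.mapRingEquiv (σ : K ≃+* K)) : K ≃+* K) : K →+* K) =
      ((σ : K ≃+* K) : K →+* K) := by
    apply IsFractionRing.ringHom_ext (A := 𝓞 K)
    intro a
    simp
  rw [coe_idealAct, coe_toPrincipalIdeal, coe_toPrincipalIdeal,
    FractionalIdeal.ringEquivOfRingEquiv_spanSingleton]
  exact congrArg _ (RingHom.congr_fun h x)

lemma coe_idealAct_mk0 (σ : K ≃ₐ[ℚ] K) (I : (Ideal (𝓞 K))⁰) :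
    (idealAct σ (FractionalIdeal.mk0 K I) : FractionalIdeal (𝓞 K)⁰ K) =
      (((I : Ideal (𝓞 K)).map ((NumberField.RingOfIntegers.mapRingEquiv (σ : K ≃+* K) :
        𝓞 K ≃+* 𝓞 K) : 𝓞 K →+* 𝓞 K) : Ideal (𝓞 K)) : FractionalIdeal (𝓞 K)⁰ K) := by
  rw [coe_idealAct, FractionalIdeal.coe_mk0, ringEquivOfRingEquiv_coeIdeal]

open scoped Pointwise in
lemma coe_idealAct_mk0_eq_smul (σ : K ≃ₐ[ℚ] K) (I : (Ideal (𝓞 K))⁰) :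
    (idealAct σ (FractionalIdeal.mk0 K I) : FractionalIdeal (𝓞 K)⁰ K) =
      ((σ • (I : Ideal (𝓞 K)) : Ideal (𝓞 K)) : FractionalIdeal (𝓞 K)⁰ K) := by
  rw [coe_idealAct_mk0]
  rfl

lemma exists_mk0_div_mk0 (J : (FractionalIdeal (𝓞 K)⁰ K)ˣ) :
    ∃ I I' : (Ideal (𝓞 K))⁰, J = FractionalIdeal.mk0 K I / FractionalIdeal.mk0 K I' := by
  obtain ⟨a, I, ha, h⟩ := FractionalIdeal.exists_eq_spanSingleton_mul
    (J : FractionalIdeal (𝓞 K)⁰ K)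
  have hI : I ≠ ⊥ := by
    rintro rfl
    simp at h
  refine ⟨⟨I, mem_nonZeroDivisors_of_ne_zero hI⟩, ⟨Ideal.span {a},
    mem_nonZeroDivisors_of_ne_zero (by simpa using ha)⟩, ?_⟩
  rw [eq_div_iff_mul_eq']
  ext1
  have ha' : algebraMap (𝓞 K) K a ≠ 0 := by simpa using ha
  rw [Units.val_mul, FractionalIdeal.coe_mk0, FractionalIdeal.coe_mk0, h,
    FractionalIdeal.coeIdeal_span_singleton, mul_right_comm,
    FractionalIdeal.spanSingleton_mul_spanSingleton, inv_mul_cancel₀ ha', FractionalIdeal.spanSingleton_one, one_mul]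

lemma classAct_mk (σ : K ≃ₐ[ℚ] K) (J : (FractionalIdeal (𝓞 K)⁰ K)ˣ) :
    classAct σ (ClassGroup.mk K J) = ClassGroup.mk K (idealAct σ J) := by
  have key : ∀ I : (Ideal (𝓞 K))⁰, classAct σ (ClassGroup.mk K (FractionalIdeal.mk0 K I)) =
      ClassGroup.mk K (idealAct σ (FractionalIdeal.mk0 K I)) := by
    intro I
    have h : (I : Ideal (𝓞 K)).map ((NumberField.RingOfIntegers.mapRingEquiv (σ : K ≃+* K) :
        𝓞 K ≃+* 𝓞 K) : 𝓞 K →+* 𝓞 K) ≠ ⊥ := by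
      exact (Ideal.map_eq_bot_iff_of_injective (RingEquiv.injective _)).not.2 <|
        nonZeroDivisors.coe_ne_zero I
    rw [ClassGroup.mk_mk0]
    refine (mulEquiv_mk0 _ I ⟨_, mem_nonZeroDivisors_of_ne_zero h⟩ rfl).trans ?_
    rw [← ClassGroup.mk_mk0 K]
    congr 1
    ext1
    rw [coe_idealAct_mk0, FractionalIdeal.coe_mk0]
  obtain ⟨I, I', rfl⟩ := exists_mk0_div_mk0 J
  simp only [map_div, key]

lemma mk_eq_one_iff_exists (J : (FractionalIdeal (𝓞 K)⁰ K)ˣ) :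
    ClassGroup.mk K J = 1 ↔ ∃ x : Kˣ, toPrincipalIdeal (𝓞 K) K x = J := by
  rw [ClassGroup.mk_eq_one_iff]
  constructor
  · intro h
    obtain ⟨x, hx⟩ := (FractionalIdeal.isPrincipal_iff _).1 h
    have hx0 : x ≠ 0 := by
      rintro rfl
      simp at hx
    exact ⟨Units.mk0 x hx0, by ext1; simp [hx]⟩
  · rintro ⟨x, rfl⟩
    exact (FractionalIdeal.isPrincipal_iff _).2 ⟨x, by simp⟩

/-- Unique factorization excludes torsion. Identities of fractional ideals can then be checked on a
power, in particular on a power that is principal. -/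
instance isMulTorsionFree_units_fractionalIdeal :
    IsMulTorsionFree (FractionalIdeal (𝓞 K)⁰ K)ˣ where
  pow_left_injective n hn J J' h := by
    have key : ∀ I : (FractionalIdeal (𝓞 K)⁰ K)ˣ, I ^ n = 1 → I = 1 := by
      intro I hI
      obtain ⟨A, B, rfl⟩ := exists_mk0_div_mk0 I
      rw [div_pow, div_eq_one, ← map_pow, ← map_pow] at hI
      have h1 := congrArg Units.val hI
      rw [FractionalIdeal.coe_mk0, FractionalIdeal.coe_mk0, FractionalIdeal.coeIdeal_inj] at h1
      have h2 : (A : Ideal (𝓞 K)) = B := pow_left_injective hn (by simpa using h1)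
      rw [Subtype.ext h2, div_self']
    have := key (J / J') (by rw [div_pow, div_eq_one]; exact h)
    exact div_eq_one.1 this

lemma idealAct_mul (σ τ : K ≃ₐ[ℚ] K) (J : (FractionalIdeal (𝓞 K)⁰ K)ˣ) :
    idealAct (σ * τ) J = idealAct σ (idealAct τ J) := by
  have key : ∀ I : (Ideal (𝓞 K))⁰, idealAct (σ * τ) (FractionalIdeal.mk0 K I) =
      idealAct σ (idealAct τ (FractionalIdeal.mk0 K I)) := by
    intro I
    ext1
    rw [coe_idealAct σ, coe_idealAct_mk0, coe_idealAct_mk0, ringEquivOfRingEquiv_coeIdeal,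
      Ideal.map_map]
    rfl
  obtain ⟨I, I', rfl⟩ := exists_mk0_div_mk0 J
  simp only [map_div, key]

lemma idealAct_one (J : (FractionalIdeal (𝓞 K)⁰ K)ˣ) : idealAct 1 J = J := by
  have h : idealAct 1 (idealAct 1 J) = idealAct (1 : K ≃ₐ[ℚ] K) J := by
    rw [← idealAct_mul, one_mul]
  exact (Units.mapEquiv _).injective h

/-- The absolute norm as a homomorphism from the group of nonzero fractional ideals. -/
noncomputable def normHom : (FractionalIdeal (𝓞 K)⁰ K)ˣ →* ℚˣ :=
  Units.map (FractionalIdeal.absNorm : FractionalIdeal (𝓞 K)⁰ K →*₀ ℚ).toMonoidHom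

lemma coe_normHom (J : (FractionalIdeal (𝓞 K)⁰ K)ˣ) :
    (normHom J : ℚ) = FractionalIdeal.absNorm (J : FractionalIdeal (𝓞 K)⁰ K) := rfl

lemma normHom_pos (J : (FractionalIdeal (𝓞 K)⁰ K)ˣ) : 0 < (normHom J : ℚ) :=
  lt_of_le_of_ne (FractionalIdeal.absNorm_nonneg _) (Ne.symm (normHom J).ne_zero)

lemma coe_normHom_mk0 (I : (Ideal (𝓞 K))⁰) :
    (normHom (FractionalIdeal.mk0 K I) : ℚ) = Ideal.absNorm (I : Ideal (𝓞 K)) := by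
  rw [coe_normHom, FractionalIdeal.coe_mk0, FractionalIdeal.coeIdeal_absNorm]

lemma coe_normHom_toPrincipalIdeal (x : Kˣ) :
    (normHom (toPrincipalIdeal (𝓞 K) K x) : ℚ) = |Algebra.norm ℚ (x : K)| := by
  rw [coe_normHom, coe_toPrincipalIdeal, FractionalIdeal.absNorm_span_singleton]

lemma exists_pow_eq_toPrincipalIdeal (J : (FractionalIdeal (𝓞 K)⁰ K)ˣ) :
    ∃ n : ℕ, n ≠ 0 ∧ ∃ x : Kˣ, toPrincipalIdeal (𝓞 K) K x = J ^ n := by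
  refine ⟨_, (Fintype.card_pos (α := ClassGroup (𝓞 K))).ne', ?_⟩
  rw [← mk_eq_one_iff_exists, map_pow, pow_card_eq_one]

/-- Some power of J is principal, where this is invariance of the element norm; norms of ideals are
positive, so n-th powers determine them. -/
lemma normHom_idealAct (σ : K ≃ₐ[ℚ] K) (J : (FractionalIdeal (𝓞 K)⁰ K)ˣ) :
    normHom (idealAct σ J) = normHom J := by
  obtain ⟨n, hn, x, hx⟩ := exists_pow_eq_toPrincipalIdeal J
  have h : (normHom (idealAct σ J) : ℚ) ^ n = (normHom J : ℚ) ^ n := by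
    rw [← Units.val_pow_eq_pow_val, ← Units.val_pow_eq_pow_val, ← map_pow, ← map_pow, ← map_pow,
      ← hx, idealAct_toPrincipalIdeal, coe_normHom_toPrincipalIdeal, coe_normHom_toPrincipalIdeal]
    congr 1
    exact Algebra.norm_eq_of_algEquiv σ x
  exact Units.ext ((pow_left_inj₀ (normHom_pos _).le (normHom_pos _).le hn).1 h)

/-- The principal ideal generated by a nonzero rational number. -/
noncomputable def ratIdeal : ℚˣ →* (FractionalIdeal (𝓞 K)⁰ K)ˣ :=
  (toPrincipalIdeal (𝓞 K) K).comp (Units.map (algebraMap ℚ K : ℚ →* K))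

lemma idealAct_ratIdeal (σ : K ≃ₐ[ℚ] K) (r : ℚˣ) :
    idealAct σ (ratIdeal r) = ratIdeal r := by
  rw [ratIdeal, MonoidHom.comp_apply, idealAct_toPrincipalIdeal]
  congr 1
  ext1
  simp

lemma toPrincipalIdeal_neg (x : Kˣ) :
    toPrincipalIdeal (𝓞 K) K (-x) = toPrincipalIdeal (𝓞 K) K x := by
  ext1
  rw [coe_toPrincipalIdeal, coe_toPrincipalIdeal, Units.val_neg]
  apply FractionalIdeal.coeToSubmodule_injective
  simp only [FractionalIdeal.coe_spanSingleton, ← Set.neg_singleton, Submodule.span_neg]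

lemma prod_idealAct [IsGalois ℚ K] (J : (FractionalIdeal (𝓞 K)⁰ K)ˣ) :
    ∏ τ : K ≃ₐ[ℚ] K, idealAct τ J = ratIdeal (normHom J) := by
  obtain ⟨n, hn, x, hx⟩ := exists_pow_eq_toPrincipalIdeal J
  apply pow_left_injective hn
  simp only
  rw [← Finset.prod_pow, ← map_pow, ← map_pow, ← hx]
  simp_rw [← map_pow, ← hx, idealAct_toPrincipalIdeal]
  rw [← map_prod]
  have h : ∏ τ : K ≃ₐ[ℚ] K, Units.map (τ : K →* K) x =
      Units.map (algebraMap ℚ K : ℚ →* K) (Units.map (Algebra.norm ℚ) x) := by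
    ext1
    simpa using (Algebra.norm_eq_prod_automorphisms ℚ (x : K)).symm
  rw [h, ← MonoidHom.comp_apply]
  change ratIdeal _ = _
  -- The ideal norm of (x) is |N x|; the sign is harmless since r and -r generate the same ideal.
  rcases abs_choice (Algebra.norm ℚ (x : K)) with h | h
  · congr 1
    ext1
    rw [coe_normHom_toPrincipalIdeal, h]; rfl
  · have : normHom (toPrincipalIdeal (𝓞 K) K x) = -Units.map (Algebra.norm ℚ) x := by
      ext1
      rw [coe_normHom_toPrincipalIdeal, h]; rfl
    rw [this, ratIdeal, MonoidHom.comp_apply, MonoidHom.comp_apply, ← toPrincipalIdeal_neg]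
    congr 1
    ext1
    simp

lemma div_idealAct_mem_range {σ : K ≃ₐ[ℚ] K} (hσ : ∀ τ : K ≃ₐ[ℚ] K, τ ∈ Subgroup.zpowers σ)
    (τ : K ≃ₐ[ℚ] K) (J : (FractionalIdeal (𝓞 K)⁰ K)ˣ) :
    J / idealAct τ J ∈ (MonoidHom.id _ / idealAct σ).range := by
  obtain ⟨k, rfl⟩ := mem_powers_iff_mem_zpowers.2 (hσ τ)
  dsimp only
  induction k with
  | zero => simp [idealAct_one]
  | succ k ih =>
    rw [← div_mul_div_cancel J (idealAct (σ ^ k) J)]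
    refine mul_mem ih ⟨idealAct (σ ^ k) J, ?_⟩
    rw [pow_succ', idealAct_mul]
    rfl

open scoped Pointwise in
-- Prime factors are matched one at a time: if P divides I and lies above q, then q divides the norm
-- of I', so some conjugate τP divides I'. The quotient P/τP lies in the range by telescoping, and
-- the cofactors still have equal norms.
lemma mk0_div_mk0_mem_range [IsGalois ℚ K] {σ : K ≃ₐ[ℚ] K}
    (hσ : ∀ τ : K ≃ₐ[ℚ] K, τ ∈ Subgroup.zpowers σ) (I : Ideal (𝓞 K)) :
    ∀ (hI : I ∈ (Ideal (𝓞 K))⁰) (I' : Ideal (𝓞 K)) (hI' : I' ∈ (Ideal (𝓞 K))⁰),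
    Ideal.absNorm I = Ideal.absNorm I' →
    FractionalIdeal.mk0 K ⟨I, hI⟩ / FractionalIdeal.mk0 K ⟨I', hI'⟩ ∈
      (MonoidHom.id _ / idealAct σ).range := by
  induction I using UniqueFactorizationMonoid.induction_on_prime with
  | h₁ => exact fun hI => absurd rfl (nonZeroDivisors.ne_zero hI)
  | h₂ I hu =>
    intro hI I' hI' h
    obtain rfl := Ideal.isUnit_iff.1 hu
    rw [Ideal.absNorm_top] at h
    obtain rfl := Ideal.absNorm_eq_one_iff.1 h.symm
    rw [div_self']
    exact one_mem _
  | h₃ I P hI0 hP ih =>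
    intro hPI I' hI' h
    have hPp : P.IsPrime := Ideal.isPrime_of_prime hP
    have : NeZero P := ⟨hP.ne_zero⟩
    have hq : (Ideal.absNorm (P.under ℤ)).Prime := Nat.absNorm_under_prime P
    have hdvd : ((Ideal.absNorm (P.under ℤ) : ℕ) : ℤ) ∣ Ideal.absNorm I' := by
      rw [← h, map_mul]
      exact_mod_cast (Int.absNorm_under_dvd_absNorm P).mul_right _
    obtain ⟨P', hP', hu, J', rfl⟩ := Ideal.exists_isMaximal_dvd_of_dvd_absNorm
      (Nat.prime_iff_prime_int.1 hq) I' hdvd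
    have hlies : P'.LiesOver (Ideal.span {((Ideal.absNorm (P.under ℤ) : ℕ) : ℤ)}) := ⟨hu.symm⟩
    obtain ⟨τ, rfl⟩ := Ideal.exists_smul_eq_of_isGaloisGroup
      (Ideal.span {((Ideal.absNorm (P.under ℤ) : ℕ) : ℤ)}) P P' (K ≃ₐ[ℚ] K)
    have hI : I ∈ (Ideal (𝓞 K))⁰ := mem_nonZeroDivisors_of_ne_zero hI0
    have hPm : P ∈ (Ideal (𝓞 K))⁰ := mem_nonZeroDivisors_of_ne_zero hP.ne_zero
    have hP'0 : τ • P ≠ 0 := left_ne_zero_of_mul (nonZeroDivisors.ne_zero hI')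
    have hJ'0 : J' ≠ 0 := right_ne_zero_of_mul (nonZeroDivisors.ne_zero hI')
    have hact : FractionalIdeal.mk0 K ⟨τ • P, mem_nonZeroDivisors_of_ne_zero hP'0⟩ =
        idealAct τ (FractionalIdeal.mk0 K ⟨P, hPm⟩) := by
      ext1
      rw [coe_idealAct_mk0_eq_smul, FractionalIdeal.coe_mk0]
    have hnorm : Ideal.absNorm (τ • P) = Ideal.absNorm P := by
      have h1 := congrArg Units.val (normHom_idealAct τ (FractionalIdeal.mk0 K ⟨P, hPm⟩))
      rw [← hact, coe_normHom_mk0, coe_normHom_mk0] at h1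
      exact_mod_cast h1
    have hJ : Ideal.absNorm I = Ideal.absNorm J' := by
      rw [map_mul, map_mul, hnorm] at h
      exact mul_left_cancel₀ (Ideal.absNorm_ne_zero_iff_mem_nonZeroDivisors.2 hPm) h
    have h1 : FractionalIdeal.mk0 K ⟨P * I, hPI⟩ =
        FractionalIdeal.mk0 K ⟨P, hPm⟩ * FractionalIdeal.mk0 K ⟨I, hI⟩ := by
      rw [← map_mul]; rfl
    have h2 : FractionalIdeal.mk0 K ⟨τ • P * J', hI'⟩ =
        FractionalIdeal.mk0 K ⟨τ • P, mem_nonZeroDivisors_of_ne_zero hP'0⟩ *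
          FractionalIdeal.mk0 K ⟨J', mem_nonZeroDivisors_of_ne_zero hJ'0⟩ := by
      rw [← map_mul]; rfl
    rw [h1, h2, mul_div_mul_comm, hact]
    exact mul_mem (div_idealAct_mem_range hσ _ _) (ih hI J' _ hJ)

/-- Hilbert's Theorem 90 for fractional ideals. -/
lemma exists_div_idealAct_of_normHom_eq_one [IsGalois ℚ K] {σ : K ≃ₐ[ℚ] K}
    (hσ : ∀ τ : K ≃ₐ[ℚ] K, τ ∈ Subgroup.zpowers σ) {J : (FractionalIdeal (𝓞 K)⁰ K)ˣ}
    (hJ : normHom J = 1) : ∃ C, C / idealAct σ C = J := by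
  obtain ⟨I, I', rfl⟩ := exists_mk0_div_mk0 J
  rw [map_div, div_eq_one] at hJ
  have h := congrArg Units.val hJ
  rw [coe_normHom_mk0, coe_normHom_mk0] at h
  exact mk0_div_mk0_mem_range hσ I I.2 I' I'.2 (by exact_mod_cast h)

lemma ClassGroup_mk_surjective :
    Function.Surjective (ClassGroup.mk K : (FractionalIdeal (𝓞 K)⁰ K)ˣ →* ClassGroup (𝓞 K)) :=
  fun c => ClassGroup.induction K (fun J => ⟨J, rfl⟩) c

lemma ClassGroup_mk_ratIdeal (r : ℚˣ) : ClassGroup.mk K (ratIdeal r) = 1 :=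
  (mk_eq_one_iff_exists _).2 ⟨_, rfl⟩

/-! ### The kernel of φ² and part (i) -/

section Cyclic

variable [IsGalois ℚ K] {p : ℕ} (hdeg : Module.finrank ℚ K = p) {σ : K ≃ₐ[ℚ] K}
  (hσ : ∀ τ : K ≃ₐ[ℚ] K, τ ∈ Subgroup.zpowers σ)

include hdeg hσ

lemma prod_range_pow_eq_prod {M : Type*} [CommMonoid M] (f : (K ≃ₐ[ℚ] K) → M) :
    ∏ i ∈ Finset.range p, f (σ ^ i) = ∏ τ, f τ := by
  classical
  have ho : orderOf σ = p := by
    rw [orderOf_eq_card_of_forall_mem_zpowers hσ, IsGalois.card_aut_eq_finrank, hdeg]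
  rw [← IsCyclic.image_range_orderOf hσ, ho, Finset.prod_image]
  intro i hi j hj h
  exact pow_injOn_Iio_orderOf (by simpa [ho] using hi) (by simpa [ho] using hj) h

lemma prod_mk_idealAct (J : (FractionalIdeal (𝓞 K)⁰ K)ˣ) :
    ∏ i ∈ Finset.range p, ClassGroup.mk K (idealAct (σ ^ i) J) = 1 := by
  rw [← map_prod, prod_range_pow_eq_prod hdeg hσ (fun τ => idealAct τ J), prod_idealAct,
    ClassGroup_mk_ratIdeal]

lemma pow_eq_one_of_classAct_eq {b : ClassGroup (𝓞 K)} (hb : classAct σ b = b) : b ^ p = 1 := by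
  obtain ⟨J, rfl⟩ := ClassGroup_mk_surjective b
  rw [← prod_mk_idealAct hdeg hσ J, Finset.prod_congr rfl (g := fun _ => ClassGroup.mk K J)]
  · simp
  · intro i hi
    clear hi
    induction i with
    | zero => rw [pow_zero, idealAct_one]
    | succ i ih => rw [pow_succ', idealAct_mul, ← classAct_mk, ih, hb]

/-- With b = φ(c) fixed by σ, σ^i c = c/b^i. The product of the conjugates of c is trivial, so c^p =
b^(p(p-1)/2), while b^p = 1. Hence the p-torsion condition in `kerPhiSq` is automatic. -/
lemma pow_eq_one_of_phi_phi_eq_one (hp : p.Prime) (hp2 : p ≠ 2) {c : ClassGroup (𝓞 K)}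
    (hc : phi σ (phi σ c) = 1) : c ^ p = 1 := by
  have hφ : ∀ c, phi σ c = c / classAct σ c := fun _ => rfl
  have hb : classAct σ (phi σ c) = phi σ c := by
    rw [hφ (phi σ c), div_eq_one] at hc
    exact hc.symm
  have hbp := pow_eq_one_of_classAct_eq hdeg hσ hb
  have hσc : classAct σ c = c / phi σ c := by rw [hφ, div_div_cancel]
  generalize phi σ c = b at hb hbp hσc
  obtain ⟨C, rfl⟩ := ClassGroup_mk_surjective c
  have h : ∀ i, ClassGroup.mk K (idealAct (σ ^ i) C) = ClassGroup.mk K C / b ^ i := by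
    intro i
    induction i with
    | zero => rw [pow_zero, pow_zero, idealAct_one, div_one]
    | succ i ih =>
      rw [pow_succ', idealAct_mul, ← classAct_mk, ih, map_div, map_pow, hb, hσc, pow_succ',
        div_div]
  have hprod := prod_mk_idealAct hdeg hσ C
  simp_rw [h] at hprod
  rw [Finset.prod_div_distrib, Finset.prod_const, Finset.card_range,
    Finset.prod_pow_eq_pow_sum] at hprod
  -- Oddness of p makes p(p-1)/2 a multiple of p.
  obtain ⟨k, hk⟩ := hp.even_sub_one hp2
  have hs : ∑ i ∈ Finset.range p, i = p * k := by
    rw [Finset.sum_range_id, hk, ← two_mul, mul_left_comm, Nat.mul_div_cancel_left _ two_pos]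
  rwa [hs, pow_mul, hbp, one_pow, div_one] at hprod

end Cyclic

lemma classAct_eq_of_mem_imPhi {p : ℕ} {σ : K ≃ₐ[ℚ] K} {b : ClassGroup (𝓞 K)}
    (hb : b ∈ imPhi p σ) : classAct σ b = b := by
  obtain ⟨c, ⟨-, hc⟩, rfl⟩ := hb
  exact (div_eq_one.1 hc).symm

lemma norm_neg_of_odd_finrank (h : Odd (Module.finrank ℚ K)) (x : K) :
    Algebra.norm ℚ (-x) = -Algebra.norm ℚ x := by
  have h1 : Algebra.norm ℚ (-1 : K) = -1 := by
    have := Algebra.norm_algebraMap (S := K) (-1 : ℚ)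
    rwa [map_neg, map_one, h.neg_one_pow] at this
  rw [← neg_one_mul, map_mul, h1, neg_one_mul]

/-- A class fixed by `σ` lies in `im φ` if and only if the norm of a representing ideal is the norm
of an element. -/
theorem mk_mem_imPhi_iff [IsGalois ℚ K] {p : ℕ} (hp : p.Prime) (hp2 : p ≠ 2)
    (hdeg : Module.finrank ℚ K = p) {σ : K ≃ₐ[ℚ] K}
    (hσ : ∀ τ : K ≃ₐ[ℚ] K, τ ∈ Subgroup.zpowers σ) {J : (FractionalIdeal (𝓞 K)⁰ K)ˣ}
    (hJ : classAct σ (ClassGroup.mk K J) = ClassGroup.mk K J) :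
    ClassGroup.mk K J ∈ imPhi p σ ↔ ∃ x : Kˣ, (normHom J : ℚ) = Algebra.norm ℚ (x : K) := by
  have hodd : Odd (Module.finrank ℚ K) := hdeg ▸ hp.odd_of_ne_two hp2
  constructor
  · rintro ⟨c, -, hc⟩
    obtain ⟨C, rfl⟩ := ClassGroup_mk_surjective c
    have h1 : ClassGroup.mk K (J / (C / idealAct σ C)) = 1 := by
      rw [map_div, map_div, ← classAct_mk, div_eq_one]
      exact hc.symm
    obtain ⟨x, hx⟩ := (mk_eq_one_iff_exists _).1 h1
    have h2 : normHom J = normHom (toPrincipalIdeal (𝓞 K) K x) := by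
      rw [hx, map_div, map_div, normHom_idealAct, div_self', div_one]
    rw [h2, coe_normHom_toPrincipalIdeal]
    rcases abs_choice (Algebra.norm ℚ (x : K)) with h | h
    · exact ⟨x, h⟩
    · exact ⟨-x, by rw [h, Units.val_neg, norm_neg_of_odd_finrank hodd]⟩
  · rintro ⟨x, hx⟩
    have h1 : normHom (J / toPrincipalIdeal (𝓞 K) K x) = 1 := by
      rw [map_div, div_eq_one]
      ext1
      rw [coe_normHom_toPrincipalIdeal, ← hx, abs_of_pos (normHom_pos J)]
    obtain ⟨C, hC⟩ := exists_div_idealAct_of_normHom_eq_one hσ h1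
    have h2 : phi σ (ClassGroup.mk K C) = ClassGroup.mk K J := by
      change ClassGroup.mk K C / classAct σ (ClassGroup.mk K C) = _
      rw [classAct_mk, ← map_div, hC, map_div, (mk_eq_one_iff_exists _).2 ⟨x, rfl⟩, div_one]
    have h3 : phi σ (phi σ (ClassGroup.mk K C)) = 1 := by
      rw [h2]
      exact div_eq_one.2 hJ.symm
    exact ⟨_, ⟨pow_eq_one_of_phi_phi_eq_one hdeg hσ hp hp2 h3, h3⟩, h2⟩

end CyclicDegP

/-! ### The index of 1-σ on the unit lattice -/

namespace CyclicDegP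

open Polynomial in
-- Over ℚ, s is annihilated by the irreducible Φ_p, whose degree p-1 is the rank. So Φ_p is the
-- characteristic polynomial, and its value at 1 is p.
lemma det_one_sub_of_sum_pow_eq_zero {M : Type*} [AddCommGroup M] [Module.Free ℤ M]
    [Module.Finite ℤ M] {p : ℕ} (hp : p.Prime) (hM : Module.finrank ℤ M = p - 1)
    (s : M →ₗ[ℤ] M) (hs : ∑ i ∈ Finset.range p, s ^ i = 0) :
    LinearMap.det ((1 : M →ₗ[ℤ] M) - s) = p := by
  classical
  have : Fact p.Prime := ⟨hp⟩
  have hf : Nonempty (Fin (p - 1)) := ⟨⟨0, by have := hp.two_le; omega⟩⟩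
  let b : Module.Basis (Fin (p - 1)) ℤ M := (Module.finBasis ℤ M).reindex (finCongr hM)
  let A : Matrix (Fin (p - 1)) (Fin (p - 1)) ℤ := LinearMap.toMatrixAlgEquiv b s
  have hA : ∑ i ∈ Finset.range p, A ^ i = 0 := by
    have := congrArg (LinearMap.toMatrixAlgEquiv b) hs
    simpa only [map_sum, map_pow, map_zero] using this
  let A' : Matrix (Fin (p - 1)) (Fin (p - 1)) ℚ := (Int.castRingHom ℚ).mapMatrix A
  have hA' : ∑ i ∈ Finset.range p, A' ^ i = 0 := by
    have := congrArg (Int.castRingHom ℚ).mapMatrix hA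
    simpa only [map_sum, map_pow, map_zero] using this
  have hmin : minpoly ℚ A' = cyclotomic p ℚ := by
    refine (minpoly.eq_of_irreducible_of_monic (cyclotomic.irreducible_rat hp.pos) ?_
      (cyclotomic.monic p ℚ)).symm
    rw [cyclotomic_prime, map_sum]
    simpa only [map_pow, aeval_X] using hA'
  have hchar : A'.charpoly = cyclotomic p ℚ := by
    refine eq_of_monic_of_dvd_of_natDegree_le (cyclotomic.monic p ℚ)
      (Matrix.charpoly_monic _) (hmin ▸ Matrix.minpoly_dvd_charpoly A') ?_
    rw [Matrix.charpoly_natDegree_eq_dim, natDegree_cyclotomic, Nat.totient_prime hp,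
      Fintype.card_fin]
  have hev : A'.charpoly.eval 1 = p := by rw [hchar, eval_one_cyclotomic_prime]
  have h1 : (LinearMap.toMatrixAlgEquiv b) (1 - s) = 1 - A := by rw [map_sub, map_one]
  have h2 : LinearMap.det ((1 : M →ₗ[ℤ] M) - s) = (1 - A).det := by
    rw [← h1]
    exact (LinearMap.det_toMatrix b _).symm
  rw [h2]
  apply Int.cast_injective (α := ℚ)
  change Int.castRingHom ℚ _ = _
  rw [RingHom.map_det, map_sub, map_one]
  rwa [Matrix.eval_charpoly, map_one] at hev

lemma natCard_quotient_range_one_sub {M : Type*} [AddCommGroup M] [Module.Free ℤ M]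
    [Module.Finite ℤ M] {p : ℕ} (hp : p.Prime) (hM : Module.finrank ℤ M = p - 1)
    (s : M →ₗ[ℤ] M) (hs : ∑ i ∈ Finset.range p, s ^ i = 0) :
    Nat.card (M ⧸ ((1 : M →ₗ[ℤ] M) - s).range) = p := by
  -- A vector x fixed by s satisfies p·x = 0.
  have hinj : Function.Injective ((1 : M →ₗ[ℤ] M) - s) := by
    rw [injective_iff_map_eq_zero]
    intro x hx
    have hsx : s x = x := (sub_eq_zero.1 hx).symm
    have hi : ∀ i, (s ^ i) x = x := fun i => by
      induction i with
      | zero => rfl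
      | succ i ih => rw [pow_succ, Module.End.mul_apply, hsx, ih]
    have h := congrArg (· x) hs
    simp only [LinearMap.sum_apply, hi, Finset.sum_const, Finset.card_range,
      LinearMap.zero_apply] at h
    rw [← natCast_zsmul] at h
    exact (smul_eq_zero.1 h).resolve_left (by exact_mod_cast hp.ne_zero)
  rw [← Submodule.natAbs_det_equiv _ (LinearEquiv.ofInjective _ hinj)]
  have : ((1 : M →ₗ[ℤ] M) - s).range.subtype ∘ₗ AddMonoidHom.toIntLinearMap
      ((LinearEquiv.ofInjective _ hinj : M ≃ₗ[ℤ] ((1 : M →ₗ[ℤ] M) - s).range) : M →+ ((1 : M →ₗ[ℤ] M) - s).range) = 1 - s := by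
    ext x
    rfl
  rw [this, det_one_sub_of_sum_pow_eq_zero hp hM s hs, Int.natAbs_natCast]

lemma index_range_id_div {G : Type*} [CommGroup G] (hfree : Module.Free ℤ (Additive G))
    (hfin : Module.Finite ℤ (Additive G)) {p : ℕ} (hp : p.Prime)
    (hG : Module.finrank ℤ (Additive G) = p - 1) (s : G →* G)
    (hs : ∀ x, ∏ i ∈ Finset.range p, s^[i] x = 1) :
    (MonoidHom.id G / s).range.index = p := by
  have hpow : ∀ (i : ℕ) (x : Additive G),
      ((MonoidHom.toAdditive s).toIntLinearMap ^ i) x = Additive.ofMul (s^[i] x.toMul) := by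
    intro i x
    rw [Module.End.pow_apply]
    induction i with
    | zero => rfl
    | succ i ih => rw [Function.iterate_succ_apply', Function.iterate_succ_apply', ih]; rfl
  have h := natCard_quotient_range_one_sub hp hG (MonoidHom.toAdditive s).toIntLinearMap (by
    ext x
    simp only [LinearMap.sum_apply, hpow]
    exact hs x.toMul)
  rw [← h]
  rfl

lemma index_map_range_id_div {E G : Type*} [CommGroup E] [CommGroup G]
    (hfree : Module.Free ℤ (Additive G))
    (hfin : Module.Finite ℤ (Additive G)) {p : ℕ} (hp : p.Prime)
    (hG : Module.finrank ℤ (Additive G) = p - 1) (q : E →* G) (hq : Function.Surjective q)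
    (f : E →* E) (hf : ∀ x, q x = 1 → q (f x) = 1)
    (hprod : ∀ x, q (∏ i ∈ Finset.range p, f^[i] x) = 1) :
    ((MonoidHom.id E / f).range.map q).index = p := by
  let s : G →* G := q.liftOfSurjective hq ⟨q.comp f, fun x hx => hf x hx⟩
  have hsq : ∀ x, s (q x) = q (f x) := fun x =>
    MonoidHom.liftOfRightInverse_comp_apply q _ _ ⟨q.comp f, fun x hx => hf x hx⟩ x
  have hs : ∀ (i : ℕ) (x : E), s^[i] (q x) = q (f^[i] x) := by
    intro i x
    induction i with
    | zero => rfl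
    | succ i ih => rw [Function.iterate_succ_apply', Function.iterate_succ_apply', ih, hsq]
  have hrange : (MonoidHom.id E / f).range.map q = (MonoidHom.id G / s).range := by
    ext x
    constructor
    · rintro ⟨_, ⟨u, rfl⟩, rfl⟩
      exact ⟨q u, by simp [hsq]⟩
    · rintro ⟨y, rfl⟩
      obtain ⟨u, rfl⟩ := hq y
      exact ⟨_, ⟨u, rfl⟩, by simp [hsq]⟩
  rw [hrange]
  refine index_range_id_div hfree hfin hp hG s fun x => ?_
  obtain ⟨u, rfl⟩ := hq x
  simp_rw [hs]
  rw [← map_prod, hprod]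

variable {K : Type*} [Field K] [NumberField K]

lemma isTotallyReal_of_isGalois_of_odd_finrank [IsGalois ℚ K] (h : Odd (Module.finrank ℚ K)) :
    NumberField.IsTotallyReal K where
  isReal w := by
    have h1 := IsUnramifiedAtInfinitePlaces_of_odd_finrank h
    refine (NumberField.InfinitePlace.isUnramified_iff.1 (h1.isUnramified w)).resolve_right ?_
    rw [NumberField.InfinitePlace.not_isComplex_iff_isReal]
    exact NumberField.IsTotallyReal.isReal _

lemma rank_eq_finrank_sub_one [IsGalois ℚ K] (h : Odd (Module.finrank ℚ K)) :
    NumberField.Units.rank K = Module.finrank ℚ K - 1 := by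
  have := isTotallyReal_of_isGalois_of_odd_finrank h
  rw [NumberField.Units.rank, NumberField.InfinitePlace.card_eq_nrRealPlaces_add_nrComplexPlaces,
    ← NumberField.InfinitePlace.card_add_two_mul_card_eq_rank,
    NumberField.nrComplexPlaces_eq_zero_iff.2 this, mul_zero]

/-- The action of a field automorphism on the units of the ring of integers. -/
noncomputable def unitAct (σ : K ≃ₐ[ℚ] K) : (𝓞 K)ˣ →* (𝓞 K)ˣ :=
  Units.map (NumberField.RingOfIntegers.mapRingHom (σ : K →+* K) : 𝓞 K →* 𝓞 K)

/-- The inclusion of the units of the ring of integers in the units of the field. -/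
noncomputable def unitIncl : (𝓞 K)ˣ →* Kˣ := Units.map (algebraMap (𝓞 K) K : 𝓞 K →* K)

omit [NumberField K] in
lemma unitIncl_injective : Function.Injective (unitIncl : (𝓞 K)ˣ →* Kˣ) :=
  Units.map_injective NumberField.RingOfIntegers.coe_injective

lemma unitIncl_unitAct (σ : K ≃ₐ[ℚ] K) (u : (𝓞 K)ˣ) :
    unitIncl (unitAct σ u) = Units.map (σ : K →* K) (unitIncl u) := rfl

/-- The norm of `K / ℚ` on units. -/
noncomputable def unitsNorm : Kˣ →* ℚˣ := Units.map (Algebra.norm ℚ)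

lemma unitsNorm_unitIncl (u : (𝓞 K)ˣ) : unitsNorm (unitIncl u) = 1 ∨
    unitsNorm (unitIncl u) = -1 := by
  rcases (abs_eq zero_le_one).1 (NumberField.Units.norm K u) with h | h
  · exact Or.inl (Units.ext h)
  · exact Or.inr (Units.ext h)

lemma unitsNorm_map (σ : K ≃ₐ[ℚ] K) (x : Kˣ) :
    unitsNorm (Units.map (σ : K →* K) x) = unitsNorm x :=
  Units.ext (Algebra.norm_eq_of_algEquiv σ (x : K))

section Cyclic

variable [IsGalois ℚ K] {p : ℕ} (hdeg : Module.finrank ℚ K = p) {σ : K ≃ₐ[ℚ] K}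
  (hσ : ∀ τ : K ≃ₐ[ℚ] K, τ ∈ Subgroup.zpowers σ)

include hdeg hσ

lemma unitIncl_prod_iterate_unitAct (u : (𝓞 K)ˣ) :
    unitIncl (∏ i ∈ Finset.range p, (unitAct σ)^[i] u) =
      Units.map (algebraMap ℚ K : ℚ →* K) (unitsNorm (unitIncl u)) := by
  have h : ∀ i, unitIncl ((unitAct σ)^[i] u) =
      Units.map ((σ ^ i : K ≃ₐ[ℚ] K) : K →* K) (unitIncl u) := by
    intro i
    induction i with
    | zero => rfl
    | succ i ih => rw [Function.iterate_succ_apply', unitIncl_unitAct, ih, pow_succ']; rfl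
  simp_rw [map_prod, h]
  rw [prod_range_pow_eq_prod hdeg hσ (fun τ => Units.map (τ : K →* K) (unitIncl u))]
  ext1
  rw [Units.coe_prod]
  exact (Algebra.norm_eq_prod_automorphisms ℚ (unitIncl u : K)).symm

/-- K is totally real, so the unit rank is p-1; the product of the conjugates of a unit is its norm
±1, which is torsion. -/
lemma index_range_unitLattice (hp : p.Prime) (hp2 : p ≠ 2) :
    ((MonoidHom.id (𝓞 K)ˣ / unitAct σ).range.map
      (QuotientGroup.mk' (NumberField.Units.torsion K))).index = p := by
  have hodd : Odd (Module.finrank ℚ K) := hdeg ▸ hp.odd_of_ne_two hp2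
  refine index_map_range_id_div (G := (𝓞 K)ˣ ⧸ NumberField.Units.torsion K)
    inferInstance inferInstance hp ?_ _ (QuotientGroup.mk'_surjective _) _ ?_ ?_
  · exact (NumberField.Units.finrank_modTorsion K).trans
      ((rank_eq_finrank_sub_one hodd).trans (by rw [hdeg]))
  · intro u hu
    exact (QuotientGroup.eq_one_iff _).2
      (MonoidHom.isOfFinOrder (unitAct σ) ((QuotientGroup.eq_one_iff _).1 hu))
  · intro u
    refine (QuotientGroup.eq_one_iff _).2 ?_
    have h := unitIncl_prod_iterate_unitAct hdeg hσ u
    refine isOfFinOrder_iff_pow_eq_one.2 ⟨2, two_pos, unitIncl_injective ?_⟩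
    rw [map_pow, h, map_one]
    rcases unitsNorm_unitIncl u with h | h <;> rw [h, ← map_pow] <;> simp

end Cyclic

lemma mem_ker_toPrincipalIdeal_iff {x : Kˣ} :
    x ∈ (toPrincipalIdeal (𝓞 K) K).ker ↔ x ∈ (unitIncl : (𝓞 K)ˣ →* Kˣ).range := by
  have h1 : ∀ x : Kˣ, x ∈ (toPrincipalIdeal (𝓞 K) K).ker → ∃ a : 𝓞 K, (a : K) = x := by
    intro x hx
    have h := congrArg Units.val (MonoidHom.mem_ker.1 hx)
    rw [coe_toPrincipalIdeal, Units.val_one] at h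
    have hx1 : (x : K) ∈ (1 : FractionalIdeal (𝓞 K)⁰ K) := by
      rw [← h]
      exact FractionalIdeal.mem_spanSingleton_self _ _
    exact (FractionalIdeal.mem_one_iff _).1 hx1
  constructor
  · intro hx
    obtain ⟨a, ha⟩ := h1 x hx
    obtain ⟨b, hb⟩ := h1 x⁻¹ (inv_mem hx)
    have hab : a * b = 1 := by
      apply NumberField.RingOfIntegers.coe_injective
      rw [map_mul]
      refine (congrArg₂ (· * ·) ha hb).trans ?_
      rw [← Units.val_mul, mul_inv_cancel, Units.val_one, map_one]
    exact ⟨Units.mkOfMulEqOne a b hab, Units.ext ha⟩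
  · rintro ⟨u, rfl⟩
    rw [MonoidHom.mem_ker]
    ext1
    rw [coe_toPrincipalIdeal, Units.val_one]
    have h : FractionalIdeal.spanSingleton (𝓞 K)⁰ ((unitIncl u : Kˣ) : K) =
        ((Ideal.span {(u : 𝓞 K)} : Ideal (𝓞 K)) : FractionalIdeal (𝓞 K)⁰ K) :=
      (FractionalIdeal.coeIdeal_span_singleton (u : 𝓞 K)).symm
    rw [h, Ideal.span_singleton_eq_top.2 u.isUnit, FractionalIdeal.coeIdeal_top]

/-! ### Fixed principal ideals modulo rational ideals -/

section Cyclic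

variable [IsGalois ℚ K] {p : ℕ} (hdeg : Module.finrank ℚ K = p) {σ : K ≃ₐ[ℚ] K}
  (hσ : ∀ τ : K ≃ₐ[ℚ] K, τ ∈ Subgroup.zpowers σ)

include hdeg hσ

/-- In odd degree the torsion units are ±1 and -1 has norm -1, so the norm-one units map
isomorphically onto the units modulo torsion. -/
lemma relIndex_range_id_div_unitAct (hp : p.Prime) (hp2 : p ≠ 2) :
    (MonoidHom.id (𝓞 K)ˣ / unitAct σ).range.relIndex
      (unitsNorm.comp (unitIncl : (𝓞 K)ˣ →* Kˣ)).ker = p := by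
  have hodd : Odd (Module.finrank ℚ K) := hdeg ▸ hp.odd_of_ne_two hp2
  have hneg : ∀ u : (𝓞 K)ˣ, unitsNorm (unitIncl (-u)) = -unitsNorm (unitIncl u) := by
    intro u
    ext1
    have h : (unitIncl (-u) : K) = -(unitIncl u : K) := by
      simp [unitIncl]
    exact (congrArg _ h).trans (norm_neg_of_odd_finrank hodd _)
  set R := (MonoidHom.id (𝓞 K)ˣ / unitAct σ).range
  set N := (unitsNorm.comp (unitIncl : (𝓞 K)ˣ →* Kˣ)).ker with hN
  set q := QuotientGroup.mk' (NumberField.Units.torsion K)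
  have hRN : R ≤ N := by
    rintro _ ⟨u, rfl⟩
    rw [hN, MonoidHom.mem_ker, MonoidHom.comp_apply, MonoidHom.div_apply, map_div, map_div,
      unitIncl_unitAct, unitsNorm_map, MonoidHom.id_apply, div_self']
  have hbij : Function.Bijective (q.comp N.subtype) := by
    constructor
    · rw [injective_iff_map_eq_one]
      rintro ⟨u, hu⟩ h
      have ht : u ∈ NumberField.Units.torsion K := (QuotientGroup.eq_one_iff u).1 h
      rcases NumberField.Units.torsion_eq_one_or_neg_one_of_odd_finrank hodd ⟨u, ht⟩ with h1 | h1
      · exact Subtype.ext h1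
      · exfalso
        replace h1 : u = -1 := h1
        replace hu : unitsNorm (unitIncl u) = 1 := hu
        rw [h1, hneg, map_one, map_one] at hu
        have := congrArg Units.val hu
        norm_num at this
    · intro x
      obtain ⟨u, rfl⟩ := QuotientGroup.mk'_surjective _ x
      rcases unitsNorm_unitIncl u with h | h
      · exact ⟨⟨u, h⟩, rfl⟩
      · refine ⟨⟨-u, (hneg u).trans (by rw [h, neg_neg])⟩, ?_⟩
        refine QuotientGroup.eq.2 ?_
        change (-u)⁻¹ * u ∈ NumberField.Units.torsion K
        have h1 : (-u)⁻¹ * u = -1 := by simp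
        rw [h1]
        exact isOfFinOrder_iff_pow_eq_one.2 ⟨2, two_pos, by simp⟩
  rw [Subgroup.relIndex, ← Subgroup.index_map_of_bijective hbij, ← Subgroup.map_map,
    Subgroup.subgroupOf_map_subtype, inf_of_le_left hRN]
  exact index_range_unitLattice hdeg hσ hp hp2

/-- Hilbert's Theorem 90 for elements. -/
lemma exists_div_map_eq_of_unitsNorm_eq_one {x : Kˣ} (hx : unitsNorm x = 1) :
    ∃ y : Kˣ, y / Units.map (σ : K →* K) y = x := by
  have ho : orderOf σ = p := by
    rw [orderOf_eq_card_of_forall_mem_zpowers hσ, IsGalois.card_aut_eq_finrank, hdeg]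
  have hp0 : 0 < p := ho ▸ orderOf_pos σ
  -- Coefficients of the resolvent y = ∑ c_i σ^i(θ), which is nonzero for some θ by independence of
  -- characters.
  let c : ℕ → K := fun i => ∏ j ∈ Finset.range i, (σ ^ j : K ≃ₐ[ℚ] K) (x : K)
  have hc0 : c 0 = 1 := by simp [c]
  have hcp : c p = 1 := by
    have h := prod_range_pow_eq_prod hdeg hσ (fun τ => τ (x : K))
    rw [← Algebra.norm_eq_prod_automorphisms] at h
    refine h.trans ?_
    have h1 : Algebra.norm ℚ (x : K) = 1 := congrArg Units.val hx
    rw [h1, map_one]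
  have hcs : ∀ i, x * σ (c i) = c (i + 1) := by
    intro i
    simp only [c]
    rw [Finset.prod_range_succ', map_prod, mul_comm]
    congr 1
    refine Finset.prod_congr rfl fun j _ => ?_
    rw [pow_succ', AlgEquiv.mul_apply]
  obtain ⟨θ, hθ⟩ : ∃ θ, ∑ i ∈ Finset.range p, c i * (σ ^ i : K ≃ₐ[ℚ] K) θ ≠ 0 := by
    by_contra! hall
    have hli : LinearIndependent K (fun i : Fin p => ((σ ^ (i : ℕ) : K ≃ₐ[ℚ] K) : K → K)) := by
      refine (linearIndependent_monoidHom K K).comp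
        (fun i : Fin p => ((σ ^ (i : ℕ) : K ≃ₐ[ℚ] K) : K →* K)) fun i j hij => ?_
      refine Fin.ext (pow_injOn_Iio_orderOf (x := σ) (by simp [ho]) (by simp [ho]) ?_)
      exact AlgEquiv.ext fun z => DFunLike.congr_fun hij z
    have h0 := Fintype.linearIndependent_iff.1 hli (fun i => c i) (by
      ext θ
      rw [Finset.sum_apply]
      simpa [Finset.sum_range] using hall θ) ⟨0, hp0⟩
    exact one_ne_zero (hc0.symm.trans h0)
  have key : x * σ (∑ i ∈ Finset.range p, c i * (σ ^ i : K ≃ₐ[ℚ] K) θ) =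
      ∑ i ∈ Finset.range p, c i * (σ ^ i : K ≃ₐ[ℚ] K) θ := by
    have h1 : x * σ (∑ i ∈ Finset.range p, c i * (σ ^ i : K ≃ₐ[ℚ] K) θ) =
        ∑ i ∈ Finset.range p, c (i + 1) * (σ ^ (i + 1) : K ≃ₐ[ℚ] K) θ := by
      rw [map_sum, Finset.mul_sum]
      refine Finset.sum_congr rfl fun i _ => ?_
      rw [map_mul, ← mul_assoc, hcs, pow_succ' σ i, AlgEquiv.mul_apply]
    rw [h1]
    -- The shifted sum closes up: the terms at 0 and p agree, because c_p = N(x) = 1 and σ^p = 1.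
    have h2 := Finset.sum_range_succ (fun i => c i * (σ ^ i : K ≃ₐ[ℚ] K) θ) p
    rw [Finset.sum_range_succ', hcp, hc0, ← ho, pow_orderOf_eq_one, pow_zero, ho] at h2
    exact add_right_cancel h2
  refine ⟨Units.mk0 _ hθ, ?_⟩
  rw [div_eq_iff_eq_mul]
  exact Units.ext key.symm

omit hdeg in
lemma mem_range_algebraMap_of_fixed {x : Kˣ} (hx : Units.map (σ : K →* K) x = x) :
    ∃ r : ℚˣ, Units.map (algebraMap ℚ K : ℚ →* K) r = x := by
  have h : (x : K) ∈ (⊥ : IntermediateField ℚ K) := by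
    rw [IsGalois.mem_bot_iff_fixed]
    intro τ
    have hs : σ ∈ MulAction.stabilizer (K ≃ₐ[ℚ] K) (x : K) := congrArg Units.val hx
    exact (Subgroup.zpowers_le.2 hs) (hσ τ)
  obtain ⟨r, hr⟩ := IntermediateField.mem_bot.1 h
  have hr0 : r ≠ 0 := by
    rintro rfl
    exact x.ne_zero (by rw [← hr, map_zero])
  exact ⟨Units.mk0 r hr0, Units.ext hr⟩

/-- The group of principal ideals fixed by `σ` modulo the ideals generated by rational numbers has
order `p`. -/
theorem relIndex_range_ratIdeal (hp : p.Prime) (hp2 : p ≠ 2) :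
    (ratIdeal : ℚˣ →* (FractionalIdeal (𝓞 K)⁰ K)ˣ).range.relIndex
      ((toPrincipalIdeal (𝓞 K) K).range ⊓ (idealAct σ).eqLocus (MonoidHom.id _)) = p := by
  set π := toPrincipalIdeal (𝓞 K) K
  set d : Kˣ →* Kˣ := MonoidHom.id Kˣ / Units.map (σ : K →* K) with hd
  have hd_apply : ∀ x, d x = x / Units.map (σ : K →* K) x := fun _ => rfl
  set Q : Subgroup Kˣ := (Units.map (algebraMap ℚ K : ℚ →* K)).range
  have hdQ : d.ker = Q := by
    ext x
    rw [MonoidHom.mem_ker, hd_apply, div_eq_one]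
    constructor
    · intro h
      exact mem_range_algebraMap_of_fixed hσ h.symm
    · rintro ⟨r, rfl⟩
      ext1
      simp
  have hker : π.ker = (unitIncl : (𝓞 K)ˣ →* Kˣ).range := by
    ext x
    exact mem_ker_toPrincipalIdeal_iff
  have hmapQ : (ratIdeal : ℚˣ →* (FractionalIdeal (𝓞 K)⁰ K)ˣ).range = Q.map π :=
    MonoidHom.range_comp _ _
  have hmapA : π.range ⊓ (idealAct σ).eqLocus (MonoidHom.id _) = (π.ker.comap d).map π := by
    have hiff : ∀ x, x ∈ π.ker.comap d ↔ idealAct σ (π x) = π x := by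
      intro x
      rw [Subgroup.mem_comap, MonoidHom.mem_ker, hd_apply, map_div, div_eq_one,
        idealAct_toPrincipalIdeal]
      exact eq_comm
    ext J
    constructor
    · rintro ⟨⟨x, rfl⟩, h⟩
      exact ⟨x, (hiff x).2 h, rfl⟩
    · rintro ⟨x, hx, rfl⟩
      exact ⟨⟨x, rfl⟩, (hiff x).1 hx⟩
  have hkerA : π.ker ≤ π.ker.comap d := by
    rw [hker]
    rintro _ ⟨u, rfl⟩
    exact ⟨u / unitAct σ u, by rw [map_div, unitIncl_unitAct, hd_apply]⟩
  rw [hmapQ, hmapA, Subgroup.relIndex_map_map, sup_of_le_left hkerA]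
  -- Here (x) is fixed exactly when d x is a unit, and d has kernel ℚˣ, so the index can be computed
  -- after applying d.
  have h1 : (π.ker.map d).relIndex ((π.ker.comap d).map d) =
      (Q ⊔ π.ker).relIndex (π.ker.comap d) := by
    rw [Subgroup.relIndex_map_map, hdQ, sup_comm]
    congr 1
    refine sup_of_le_left ?_
    rw [← hdQ]
    intro x hx
    rw [Subgroup.mem_comap, MonoidHom.mem_ker.1 hx]
    exact one_mem _
  rw [← h1]
  have h2 : π.ker.map d = (MonoidHom.id (𝓞 K)ˣ / unitAct σ).range.map unitIncl := by
    rw [hker, ← MonoidHom.range_comp, ← MonoidHom.range_comp]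
    congr 1
  have h3 : (π.ker.comap d).map d = (unitsNorm.comp (unitIncl : (𝓞 K)ˣ →* Kˣ)).ker.map unitIncl := by
    rw [hker]
    ext x
    constructor
    · rintro ⟨y, ⟨u, hu⟩, rfl⟩
      refine ⟨u, ?_, hu⟩
      change unitsNorm (unitIncl u) = 1
      rw [hu, hd_apply, map_div, unitsNorm_map, div_self']
    · rintro ⟨u, hu, rfl⟩
      obtain ⟨y, hy⟩ := exists_div_map_eq_of_unitsNorm_eq_one hdeg hσ hu
      exact ⟨y, ⟨u, hy.symm⟩, hy⟩
  rw [h2, h3, Subgroup.relIndex_map_map_of_injective _ _ unitIncl_injective]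
  exact relIndex_range_id_div_unitAct hdeg hσ hp hp2

end Cyclic

/-! ### Ramified and unramified primes -/

lemma emultiplicity_span_intCast {q : ℕ} (hq : q.Prime) (P : Ideal (𝓞 K)) [hP : P.IsPrime]
    [hl : P.LiesOver (Ideal.span {(q : ℤ)})] {m : ℤ} (hm : m ≠ 0) :
    emultiplicity P (Ideal.span {(m : 𝓞 K)}) =
      (P.ramificationIdx ℤ : ℕ∞) * emultiplicity (q : ℤ) m := by
  have hqp : Prime (q : ℤ) := Nat.prime_iff_prime_int.1 hq
  have hq0 : Ideal.span {(q : ℤ)} ≠ ⊥ := by simpa using hq.ne_zero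
  have hP0 : P ≠ ⊥ := Ideal.ne_bot_of_liesOver_of_ne_bot hq0 P
  have h := Ideal.IsDedekindDomain.emultiplicity_map_eq_ramificationIdx'_mul
    (v := Ideal.span {(q : ℤ)}) (w := P) (I := Ideal.span {m}) (by simpa using hm)
    ((Ideal.prime_iff_isPrime hq0).2 ((Ideal.span_singleton_prime hqp.ne_zero).2 hqp)).irreducible
    ((Ideal.prime_iff_isPrime hP0).2 hP).irreducible hP0
  rw [Ideal.map_span, Set.image_singleton, Ideal.emultiplicity_eq_emultiplicity_span,
    Ideal.ramificationIdx'_eq_ramificationIdx _ _ hq0] at h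
  simpa using h

lemma exists_isPrime_liesOver {q : ℕ} (hq : q.Prime) :
    ∃ P : Ideal (𝓞 K), P.IsPrime ∧ P.LiesOver (Ideal.span {(q : ℤ)}) := by
  have hqp : Prime (q : ℤ) := Nat.prime_iff_prime_int.1 hq
  have h1 := (Ideal.span_singleton_prime hqp.ne_zero).2 hqp
  have h2 : (Ideal.span {(q : ℤ)}).IsMaximal := h1.isMaximal (by simpa using hq.ne_zero)
  obtain ⟨P, hP, hl⟩ := Ideal.exists_maximal_ideal_liesOver_of_isIntegral (S := 𝓞 K)
    (Ideal.span {(q : ℤ)})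
  exact ⟨P, hP.isPrime, hl⟩

lemma emultiplicity_intCast_natCast {q : ℕ} (hq : q.Prime) {M : ℕ} (hM : M ≠ 0) :
    emultiplicity (q : ℤ) (M : ℤ) = M.factorization q := by
  have : Fact q.Prime := ⟨hq⟩
  rw [Int.natCast_emultiplicity, Nat.factorization_def M hq, padicValNat_eq_emultiplicity hM]

lemma ramificationIdx_eq_one_of_not_dvd_discr {q : ℕ} (hq : q.Prime)
    (hqd : ¬ (q : ℤ) ∣ NumberField.discr K) (P : Ideal (𝓞 K)) [hP : P.IsPrime]
    [hl : P.LiesOver (Ideal.span {(q : ℤ)})] : P.ramificationIdx ℤ = 1 := by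
  have hqp : Prime (q : ℤ) := Nat.prime_iff_prime_int.1 hq
  rw [Ideal.ramificationIdx_eq_one_iff]
  refine (NumberField.not_dvd_discr_iff_forall_mem K (𝓞 K) hqp).1 hqd P hP ?_
  simpa using (Ideal.liesOver_span_iff hP.ne_top hqp).1 hl

/-- At a prime P above the unramified q, the P-adic valuation of M is its q-adic one; the other two
valuations are multiples of p. -/
lemma dvd_factorization_of_pow_eq {q : ℕ} (hq : q.Prime)
    (hqd : ¬ (q : ℤ) ∣ NumberField.discr K) {I I' : Ideal (𝓞 K)} (hI' : I' ≠ ⊥)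
    {M p : ℕ} (hp : 0 < p) (hM : M ≠ 0) (h : I ^ p = Ideal.span {(M : 𝓞 K)} * I' ^ p) :
    p ∣ M.factorization q := by
  obtain ⟨P, hP, hl⟩ := exists_isPrime_liesOver (K := K) hq
  have hq0 : Ideal.span {(q : ℤ)} ≠ ⊥ := by simpa using hq.ne_zero
  have hP0 : P ≠ ⊥ := Ideal.ne_bot_of_liesOver_of_ne_bot hq0 P
  have hPp : Prime P := (Ideal.prime_iff_isPrime hP0).2 hP
  have hI : I ≠ ⊥ := by
    rintro rfl
    rw [Ideal.bot_pow hp.ne', eq_comm, Ideal.mul_eq_bot] at h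
    rcases h with h | h
    · simp [hM] at h
    · exact hI' (pow_eq_zero_iff hp.ne' |>.1 h)
  have h1 : emultiplicity P (Ideal.span {(M : 𝓞 K)}) = M.factorization q := by
    have := emultiplicity_span_intCast hq P (m := M) (by exact_mod_cast hM)
    rw [ramificationIdx_eq_one_of_not_dvd_discr hq hqd P, Nat.cast_one, one_mul,
      emultiplicity_intCast_natCast hq hM, Int.cast_natCast] at this
    exact this
  have h2 := congrArg (emultiplicity P) h
  rw [emultiplicity_mul hPp, emultiplicity_pow hPp, emultiplicity_pow hPp, h1,
    (FiniteMultiplicity.of_prime_left hPp hI).emultiplicity_eq_multiplicity,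
    (FiniteMultiplicity.of_prime_left hPp hI').emultiplicity_eq_multiplicity] at h2
  have h3 : p * multiplicity P I = M.factorization q + p * multiplicity P I' := by
    exact_mod_cast h2
  exact (Nat.dvd_add_left (dvd_mul_right _ _)).1 (h3 ▸ dvd_mul_right _ _)

open scoped Pointwise in
/-- A prime dividing the discriminant is totally ramified. -/
lemma exists_prime_pow_eq_of_dvd_discr [IsGalois ℚ K] {p : ℕ} (hp : p.Prime)
    (hdeg : Module.finrank ℚ K = p) {q : ℕ} (hq : q.Prime)
    (hqd : (q : ℤ) ∣ NumberField.discr K) :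
    ∃ P : Ideal (𝓞 K), P.IsPrime ∧ P.LiesOver (Ideal.span {(q : ℤ)}) ∧
      P ^ p = Ideal.span {(q : 𝓞 K)} ∧ Ideal.absNorm P = q ∧ P.ramificationIdx ℤ = p ∧
      ∀ τ : K ≃ₐ[ℚ] K, τ • P = P := by
  have hqp : Prime (q : ℤ) := Nat.prime_iff_prime_int.1 hq
  have hq0 : Ideal.span {(q : ℤ)} ≠ ⊥ := by simpa using hq.ne_zero
  have hspan : (Ideal.span {(q : ℤ)}).IsPrime := (Ideal.span_singleton_prime hqp.ne_zero).2 hqp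
  obtain ⟨P, hP, hqP, hun⟩ : ∃ P : Ideal (𝓞 K), ∃ _ : P.IsPrime, (q : 𝓞 K) ∈ P ∧
      ¬ Algebra.IsUnramifiedAt ℤ P := by
    by_contra! hall
    exact (NumberField.not_dvd_discr_iff_forall_mem K (𝓞 K) hqp).2
      (fun P hP h => hall P hP (by simpa using h)) hqd
  have hl : P.LiesOver (Ideal.span {(q : ℤ)}) :=
    (Ideal.liesOver_span_iff hP.ne_top hqp).2 (by simpa using hqP)
  have hP0 : P ≠ ⊥ := Ideal.ne_bot_of_liesOver_of_ne_bot hq0 P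
  -- The relation gef = p leaves only e = 1 or e = p.
  have he : P.ramificationIdx ℤ = p := by
    have h1 := Ideal.ncard_primesOver_mul_ramificationIdxIn_mul_inertiaDegIn
      (Ideal.span {(q : ℤ)}) (𝓞 K) (K ≃ₐ[ℚ] K)
    rw [Ideal.ramificationIdxIn_eq_ramificationIdx _ P (K ≃ₐ[ℚ] K),
      IsGalois.card_aut_eq_finrank, hdeg] at h1
    have h2 : P.ramificationIdx ℤ ∣ p := h1 ▸ (dvd_mul_right _ _).mul_left _
    refine ((Nat.dvd_prime hp).1 h2).resolve_left fun h => hun ?_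
    exact Ideal.ramificationIdx_eq_one_iff.1 h
  have hdvd : P ^ p ∣ Ideal.span {(q : 𝓞 K)} := by
    rw [Ideal.dvd_iff_le, ← he, ← Ideal.ramificationIdx'_eq_ramificationIdx _ P hq0]
    have := Ideal.le_pow_ramificationIdx' (p := Ideal.span {(q : ℤ)}) (P := P)
    rwa [Ideal.map_span, Set.image_singleton, map_natCast] at this
  have hNq : Ideal.absNorm (Ideal.span {(q : 𝓞 K)}) = q ^ p := by
    rw [Ideal.absNorm_span_singleton]
    have := Algebra.norm_algebraMap (S := 𝓞 K) (q : ℤ)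
    rw [map_natCast, NumberField.RingOfIntegers.rank, hdeg] at this
    rw [this, ← Nat.cast_pow, Int.natAbs_natCast]
  have hNP := Ideal.absNorm_eq_pow_inertiaDeg' P hq
  have hf0 : (Ideal.span {(q : ℤ)}).inertiaDeg' P ≠ 0 := by
    intro h
    rw [h, pow_zero, Ideal.absNorm_eq_one_iff] at hNP
    exact hP.ne_top hNP
  obtain ⟨J, hJ⟩ := hdvd
  have hN := congrArg Ideal.absNorm hJ
  rw [map_mul, map_pow, hNq, hNP, ← pow_mul] at hN
  have hf1 : (Ideal.span {(q : ℤ)}).inertiaDeg' P = 1 := by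
    have h1 : (Ideal.span {(q : ℤ)}).inertiaDeg' P * p ≤ p :=
      (Nat.pow_dvd_pow_iff_le_right hq.one_lt).1 ⟨_, hN⟩
    have := hp.pos
    have := Nat.pos_of_ne_zero hf0
    nlinarith
  rw [hf1, one_mul] at hN
  have hJ1 : Ideal.absNorm J = 1 :=
    (mul_eq_left₀ (pow_ne_zero _ hq.ne_zero)).1 hN.symm
  have hpow : P ^ p = Ideal.span {(q : 𝓞 K)} := by
    rw [hJ, Ideal.absNorm_eq_one_iff.1 hJ1, Ideal.mul_top]
  refine ⟨P, hP, hl, hpow, by rw [hNP, hf1, pow_one], he, fun τ => ?_⟩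
  -- P is the unique p-th root of the Galois-stable ideal (q).
  apply pow_left_injective hp.ne_zero
  simp only
  rw [← smul_pow', hpow, Ideal.pointwise_smul_def, Ideal.map_span, Set.image_singleton,
    map_natCast]

end CyclicDegP

/-! ### Fixed ideals and their norms -/

namespace CyclicDegP

/-- Every nonzero natural number is a `p`-th power times a `p`-th-power-free number. -/
lemma exists_eq_mul_pow_of_ne_zero {p : ℕ} (hp : 0 < p) (M : ℕ) (hM : M ≠ 0) :
    ∃ b s : ℕ, M = b * s ^ p ∧ b ≠ 0 ∧ s ≠ 0 ∧ ∀ q : ℕ, q.Prime → b.factorization q < p := by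
  induction M using Nat.strong_induction_on with
  | _ M ih =>
    by_cases h : ∃ q : ℕ, q.Prime ∧ q ^ p ∣ M
    · obtain ⟨q, hq, M', rfl⟩ := h
      have hM' : M' ≠ 0 := right_ne_zero_of_mul hM
      have hlt : M' < q ^ p * M' :=
        lt_mul_of_one_lt_left (Nat.pos_of_ne_zero hM') (Nat.one_lt_pow hp.ne' hq.one_lt)
      obtain ⟨b, s, hbs, hb, hs, hfac⟩ := ih M' hlt hM'
      exact ⟨b, q * s, by rw [hbs]; ring, hb, mul_ne_zero hq.ne_zero hs, hfac⟩
    · push Not at h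
      refine ⟨M, 1, by simp, hM, one_ne_zero, fun q hq => ?_⟩
      by_contra! hle
      exact h q hq ((hq.pow_dvd_iff_le_factorization hM).2 hle)

variable {K : Type*} [Field K] [NumberField K]

/-- The group of fractional ideals fixed by `σ`. -/
noncomputable def fixedIdeals (σ : K ≃ₐ[ℚ] K) : Subgroup (FractionalIdeal (𝓞 K)⁰ K)ˣ :=
  (idealAct σ).eqLocus (MonoidHom.id _)

/-- The group of fractional ideals fixed by `σ` whose norm is the norm of an element. -/
noncomputable def fixedNormIdeals (σ : K ≃ₐ[ℚ] K) : Subgroup (FractionalIdeal (𝓞 K)⁰ K)ˣ :=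
  fixedIdeals σ ⊓ (unitsNorm : Kˣ →* ℚˣ).range.comap normHom

lemma mem_fixedIdeals {σ : K ≃ₐ[ℚ] K} {J : (FractionalIdeal (𝓞 K)⁰ K)ˣ} :
    J ∈ fixedIdeals σ ↔ idealAct σ J = J := Iff.rfl

section Cyclic

variable [IsGalois ℚ K] {p : ℕ} (hp : p.Prime) (hdeg : Module.finrank ℚ K = p) {σ : K ≃ₐ[ℚ] K}
  (hσ : ∀ τ : K ≃ₐ[ℚ] K, τ ∈ Subgroup.zpowers σ)

lemma coe_normHom_ratIdeal (r : ℚˣ) :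
    (normHom (ratIdeal r : (FractionalIdeal (𝓞 K)⁰ K)ˣ) : ℚ) =
      |(r : ℚ)| ^ Module.finrank ℚ K := by
  rw [ratIdeal, MonoidHom.comp_apply, coe_normHom_toPrincipalIdeal, ← abs_pow]
  congr 1
  exact Algebra.norm_algebraMap (S := K) (r : ℚ)

omit [IsGalois ℚ K] in
include hσ in
lemma idealAct_eq_of_mem_fixedIdeals {J : (FractionalIdeal (𝓞 K)⁰ K)ˣ} (hJ : J ∈ fixedIdeals σ)
    (τ : K ≃ₐ[ℚ] K) : idealAct τ J = J := by
  obtain ⟨k, rfl⟩ := mem_powers_iff_mem_zpowers.2 (hσ τ)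
  dsimp only
  induction k with
  | zero => rw [pow_zero, idealAct_one]
  | succ k ih => rw [pow_succ', idealAct_mul, ih, mem_fixedIdeals.1 hJ]

include hdeg hσ

/-- All p conjugates of J coincide, and their product is generated by the norm. -/
lemma pow_eq_ratIdeal_of_mem_fixedIdeals {J : (FractionalIdeal (𝓞 K)⁰ K)ˣ}
    (hJ : J ∈ fixedIdeals σ) : J ^ p = ratIdeal (normHom J) := by
  rw [← prod_idealAct, Finset.prod_congr rfl fun τ _ => idealAct_eq_of_mem_fixedIdeals hσ hJ τ,
    Finset.prod_const, Finset.card_univ, ← Nat.card_eq_fintype_card,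
    IsGalois.card_aut_eq_finrank, hdeg]

include hp

lemma eq_of_normHom_eq {J J' : (FractionalIdeal (𝓞 K)⁰ K)ˣ} (hJ : J ∈ fixedIdeals σ)
    (hJ' : J' ∈ fixedIdeals σ) (h : normHom J = normHom J') : J = J' := by
  apply pow_left_injective hp.ne_zero
  simp only
  rw [pow_eq_ratIdeal_of_mem_fixedIdeals hdeg hσ hJ, pow_eq_ratIdeal_of_mem_fixedIdeals hdeg hσ hJ',
    h]

omit hσ in
-- The totally ramified prime above each prime factor q of b is fixed and has norm q.
lemma exists_mem_fixedIdeals_normHom_eq (b : ℕ) (hb : b ≠ 0)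
    (hbr : ∀ q : ℕ, q.Prime → q ∣ b → (q : ℤ) ∣ NumberField.discr K) :
    ∃ J ∈ fixedIdeals σ, (normHom J : ℚ) = b := by
  induction b using induction_on_primes with
  | zero => exact absurd rfl hb
  | one => exact ⟨1, one_mem _, by simp⟩
  | prime_mul q b hq ih =>
    obtain ⟨J, hJ, hJb⟩ := ih (right_ne_zero_of_mul hb)
      (fun q' hq' h => hbr q' hq' (h.mul_left _))
    obtain ⟨P, hP, -, -, hN, -, hfix⟩ := exists_prime_pow_eq_of_dvd_discr hp hdeg hq
      (hbr q hq (dvd_mul_right _ _))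
    have hP0 : P ≠ ⊥ := by
      rintro rfl
      rw [Ideal.absNorm_bot] at hN
      exact hq.ne_zero hN.symm
    refine ⟨FractionalIdeal.mk0 K ⟨P, mem_nonZeroDivisors_of_ne_zero hP0⟩ * J,
      mul_mem ?_ hJ, ?_⟩
    · rw [mem_fixedIdeals]
      ext1
      rw [coe_idealAct_mk0_eq_smul, hfix, FractionalIdeal.coe_mk0]
    · rw [map_mul, Units.val_mul, hJb, coe_normHom_mk0, hN, Nat.cast_mul]

lemma dvd_factorization_of_mem_fixedIdeals {J : (FractionalIdeal (𝓞 K)⁰ K)ˣ}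
    (hJ : J ∈ fixedIdeals σ) {M : ℕ} (hM : M ≠ 0) (hJM : (normHom J : ℚ) = M) {q : ℕ}
    (hq : q.Prime) (hqd : ¬ (q : ℤ) ∣ NumberField.discr K) : p ∣ M.factorization q := by
  have h := pow_eq_ratIdeal_of_mem_fixedIdeals hdeg hσ hJ
  obtain ⟨I, I', rfl⟩ := exists_mk0_div_mk0 J
  rw [div_pow, div_eq_iff_eq_mul] at h
  have h1 := congrArg Units.val h
  refine dvd_factorization_of_pow_eq hq hqd (I := I) (I' := I') (nonZeroDivisors.coe_ne_zero I')
    hp.pos hM ?_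
  have h2 : ((ratIdeal (normHom (FractionalIdeal.mk0 K I / FractionalIdeal.mk0 K I')) :
      (FractionalIdeal (𝓞 K)⁰ K)ˣ) : FractionalIdeal (𝓞 K)⁰ K) =
      ((Ideal.span {(M : 𝓞 K)} : Ideal (𝓞 K)) : FractionalIdeal (𝓞 K)⁰ K) := by
    rw [ratIdeal, MonoidHom.comp_apply, coe_toPrincipalIdeal,
      FractionalIdeal.coeIdeal_span_singleton]
    congr 1
    rw [Units.coe_map]
    change algebraMap ℚ K _ = _
    rw [hJM, map_natCast, map_natCast]
  rw [Units.val_mul, h2, Units.val_pow_eq_pow_val, Units.val_pow_eq_pow_val,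
    FractionalIdeal.coe_mk0, FractionalIdeal.coe_mk0, ← FractionalIdeal.coeIdeal_pow,
    ← FractionalIdeal.coeIdeal_pow, ← FractionalIdeal.coeIdeal_mul] at h1
  exact FractionalIdeal.coeIdeal_injective h1

end Cyclic

/-! ### Index computation and counting -/

section Cyclic

variable [IsGalois ℚ K] {p : ℕ} (hp : p.Prime) (hp2 : p ≠ 2) (hdeg : Module.finrank ℚ K = p)
  {σ : K ≃ₐ[ℚ] K} (hσ : ∀ τ : K ≃ₐ[ℚ] K, τ ∈ Subgroup.zpowers σ)

include hp hp2 hdeg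

omit [IsGalois ℚ K] in
lemma normHom_toPrincipalIdeal_mem (x : Kˣ) :
    normHom (toPrincipalIdeal (𝓞 K) K x) ∈ (unitsNorm : Kˣ →* ℚˣ).range := by
  rcases abs_choice (Algebra.norm ℚ (x : K)) with h | h
  · exact ⟨x, Units.ext (h.symm.trans (coe_normHom_toPrincipalIdeal x).symm)⟩
  · refine ⟨-x, Units.ext ?_⟩
    rw [coe_normHom_toPrincipalIdeal, h]
    exact norm_neg_of_odd_finrank (hdeg ▸ hp.odd_of_ne_two hp2) _

include hσ

/-- J/σJ = (x) with N(x) = ±1, and the sign can be made +1. Then x = y/σy by Hilbert 90, and J/(y)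
is fixed. -/
lemma exists_fixed_representative {J : (FractionalIdeal (𝓞 K)⁰ K)ˣ}
    (hJ : classAct σ (ClassGroup.mk K J) = ClassGroup.mk K J) :
    ∃ J' ∈ fixedIdeals σ, ClassGroup.mk K J' = ClassGroup.mk K J := by
  have hodd : Odd (Module.finrank ℚ K) := hdeg ▸ hp.odd_of_ne_two hp2
  rw [classAct_mk, eq_comm, ← div_eq_one, ← map_div] at hJ
  obtain ⟨x, hx⟩ := (mk_eq_one_iff_exists _).1 hJ
  have hx1 : |Algebra.norm ℚ (x : K)| = 1 := by
    rw [← coe_normHom_toPrincipalIdeal, hx, map_div, normHom_idealAct, div_self', Units.val_one]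
  obtain ⟨x', hx', hN⟩ : ∃ x' : Kˣ, toPrincipalIdeal (𝓞 K) K x' = J / idealAct σ J ∧
      unitsNorm x' = 1 := by
    rcases (abs_eq zero_le_one).1 hx1 with h | h
    · exact ⟨x, hx, Units.ext h⟩
    · refine ⟨-x, (toPrincipalIdeal_neg x).trans hx, Units.ext ?_⟩
      exact (norm_neg_of_odd_finrank hodd _).trans (by rw [h, neg_neg, Units.val_one])
  obtain ⟨y, rfl⟩ := exists_div_map_eq_of_unitsNorm_eq_one hdeg hσ hN
  refine ⟨J / toPrincipalIdeal (𝓞 K) K y, ?_, ?_⟩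
  · rw [mem_fixedIdeals, map_div, idealAct_toPrincipalIdeal]
    rw [map_div] at hx'
    rw [div_eq_div_iff_mul_eq_mul, mul_comm]
    exact div_eq_div_iff_mul_eq_mul.1 hx'
  · rw [map_div, (mk_eq_one_iff_exists _).2 ⟨y, rfl⟩, div_one]

lemma map_mk_fixedNormIdeals :
    (fixedNormIdeals σ).map (ClassGroup.mk K) = imPhi p σ := by
  have key : ∀ J ∈ fixedIdeals σ, (ClassGroup.mk K J ∈ imPhi p σ ↔ J ∈ fixedNormIdeals σ) := by
    intro J hJ
    rw [mk_mem_imPhi_iff hp hp2 hdeg hσ (by rw [classAct_mk, mem_fixedIdeals.1 hJ])]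
    constructor
    · rintro ⟨x, hx⟩
      exact ⟨hJ, x, Units.ext hx.symm⟩
    · rintro ⟨-, x, hx⟩
      exact ⟨x, (congrArg Units.val hx).symm⟩
  ext c
  constructor
  · rintro ⟨J, hJ, rfl⟩
    exact (key J hJ.1).2 hJ
  · intro hc
    obtain ⟨J, rfl⟩ := ClassGroup_mk_surjective c
    obtain ⟨J', hJ', h⟩ := exists_fixed_representative hp hp2 hdeg hσ (classAct_eq_of_mem_imPhi hc)
    rw [← h] at hc ⊢
    exact ⟨J', (key J' hJ').1 hc, rfl⟩

lemma relIndex_principal_fixedNormIdeals :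
    ((toPrincipalIdeal (𝓞 K) K).range ⊓ fixedIdeals σ).relIndex (fixedNormIdeals σ) =
      Nat.card (imPhi p σ) := by
  have h1 : ((toPrincipalIdeal (𝓞 K) K).range ⊓ fixedIdeals σ).subgroupOf (fixedNormIdeals σ) =
      ((ClassGroup.mk K).comp (fixedNormIdeals σ).subtype).ker := by
    ext J
    rw [Subgroup.mem_subgroupOf, MonoidHom.mem_ker, MonoidHom.comp_apply]
    refine Iff.trans ?_ (mk_eq_one_iff_exists _).symm
    exact ⟨fun h => h.1, fun h => ⟨h, J.2.1⟩⟩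
  rw [Subgroup.relIndex, h1, Subgroup.index_ker, MonoidHom.range_comp, Subgroup.range_subtype,
    map_mk_fixedNormIdeals hp hp2 hdeg hσ]

lemma relIndex_ratIdeal_fixedNormIdeals :
    (ratIdeal : ℚˣ →* (FractionalIdeal (𝓞 K)⁰ K)ˣ).range.relIndex (fixedNormIdeals σ) =
      p * Nat.card (imPhi p σ) := by
  rw [← relIndex_principal_fixedNormIdeals hp hp2 hdeg hσ,
    ← relIndex_range_ratIdeal hdeg hσ hp hp2]
  refine (Subgroup.relIndex_mul_relIndex _ _ _ ?_ ?_).symm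
  · rintro _ ⟨r, rfl⟩
    exact ⟨⟨_, rfl⟩, idealAct_ratIdeal σ r⟩
  · rintro _ ⟨⟨x, rfl⟩, h⟩
    exact ⟨h, normHom_toPrincipalIdeal_mem hp hp2 hdeg x⟩

/-- Send b to the fixed ideal of norm b. A rational ideal (r) has norm |r|^p, so a coset determines
its norms up to p-th powers, and each coset has a unique representative of p-th-power-free integral
norm. -/
lemma ncard_eq_relIndex (hD0 : normDisc p K ≠ 0)
    (hD : ∀ q : ℕ, q.Prime → (normDisc p K).natAbs.factorization q =
      if (q : ℤ) ∣ NumberField.discr K then p - 1 else 0) :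
    {b : ℕ | (b : ℤ) ∣ normDisc p K ∧
        ∃ α : Kˣ, (b : ℚ) = Algebra.norm ℚ (α : K)}.ncard =
      (ratIdeal : ℚˣ →* (FractionalIdeal (𝓞 K)⁰ K)ˣ).range.relIndex (fixedNormIdeals σ) := by
  set T := {b : ℕ | (b : ℤ) ∣ normDisc p K ∧ ∃ α : Kˣ, (b : ℚ) = Algebra.norm ℚ (α : K)} with hT
  have hD0' : (normDisc p K).natAbs ≠ 0 := Int.natAbs_ne_zero.2 hD0
  have hT0 : ∀ b ∈ T, b ≠ 0 := by
    rintro b ⟨hb, -⟩ rfl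
    exact hD0 (zero_dvd_iff.1 (by simpa using hb))
  have hTfac : ∀ b ∈ T, ∀ q : ℕ, q.Prime →
      b.factorization q ≤ if (q : ℤ) ∣ NumberField.discr K then p - 1 else 0 := by
    intro b hb q hq
    rw [← hD q hq]
    exact (Nat.factorization_prime_le_iff_dvd (hT0 b hb) hD0').2 (Int.natCast_dvd.1 hb.1) q hq
  have hTlt : ∀ b ∈ T, ∀ q : ℕ, q.Prime → b.factorization q < p := by
    intro b hb q hq
    have h := hTfac b hb q hq
    have := hp.pos
    split_ifs at h <;> omega
  have hex : ∀ b : T, ∃ J : fixedNormIdeals σ, (normHom (J : (FractionalIdeal (𝓞 K)⁰ K)ˣ) : ℚ) =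
      (b : ℕ) := by
    rintro ⟨b, hb⟩
    obtain ⟨J, hJ, hJb⟩ := exists_mem_fixedIdeals_normHom_eq hp hdeg (σ := σ) b (hT0 b hb) (by
      intro q hq hqb
      by_contra hqd
      have h := hTfac b hb q hq
      rw [if_neg hqd] at h
      have := (hq.dvd_iff_one_le_factorization (hT0 b hb)).1 hqb
      omega)
    obtain ⟨-, α, hα⟩ := hb
    exact ⟨⟨J, hJ, α, Units.ext (hα.symm.trans hJb.symm)⟩, hJb⟩
  choose f hf using hex
  rw [Subgroup.relIndex, ← Nat.card_coe_set_eq]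
  refine Nat.card_congr (Equiv.ofBijective (fun b => QuotientGroup.mk (f b)) ⟨?_, ?_⟩)
  · intro b b' hbb'
    obtain ⟨r, hr⟩ := QuotientGroup.eq.1 hbb'
    have hnorm : ((b : ℕ) : ℚ) * |(r : ℚ)| ^ p = (b' : ℕ) := by
      rw [← hf b, ← hf b', ← hdeg, ← coe_normHom_ratIdeal (K := K) r, ← Units.val_mul, ← map_mul]
      rw [hr]
      simp
    have hden : ((b : ℕ) * (r : ℚ).num.natAbs ^ p : ℕ) = (b' : ℕ) * (r : ℚ).den ^ p := by
      have h1 : |(r : ℚ)| = ((r : ℚ).num.natAbs : ℚ) / (r : ℚ).den := by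
        conv_lhs => rw [← Rat.num_div_den (r : ℚ)]
        rw [abs_div, Nat.abs_cast, Nat.cast_natAbs, Int.cast_abs]
      have h2 : ((r : ℚ).den : ℚ) ≠ 0 := by exact_mod_cast (r : ℚ).den_nz
      rw [h1, div_pow, ← mul_div_assoc, div_eq_iff (pow_ne_zero _ h2)] at hnorm
      exact_mod_cast hnorm
    have hn0 : (r : ℚ).num.natAbs ≠ 0 := by simp
    refine Subtype.ext (Nat.eq_of_factorization_eq (hT0 b b.2) (hT0 b' b'.2) fun q => ?_)
    by_cases hq : q.Prime
    · have h1 := congrArg (fun n => n.factorization q % p) hden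
      simp only [Nat.factorization_mul (hT0 b b.2) (pow_ne_zero p hn0),
        Nat.factorization_mul (hT0 b' b'.2) (pow_ne_zero p (r : ℚ).den_nz), Nat.factorization_pow,
        Finsupp.add_apply, Finsupp.smul_apply, smul_eq_mul, Nat.add_mul_mod_self_left] at h1
      rwa [Nat.mod_eq_of_lt (hTlt b b.2 q hq), Nat.mod_eq_of_lt (hTlt b' b'.2 q hq)] at h1
    · rw [Nat.factorization_eq_zero_of_not_prime _ hq, Nat.factorization_eq_zero_of_not_prime _ hq]
  · intro c
    obtain ⟨⟨J, hJ⟩, rfl⟩ := QuotientGroup.mk_surjective c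
    have hr := normHom_pos J
    set r : ℚ := ((normHom J : ℚˣ) : ℚ) with hrdef
    have hn0 : (r.den : ℚ) ≠ 0 := by exact_mod_cast r.den_nz
    have hnum : (r.num.natAbs : ℚ) = r.num := by
      rw [Nat.cast_natAbs, abs_of_pos (Rat.num_pos.2 hr)]
    -- This integer is r·den^p. Writing it as b·s^p with b p-th-power-free, t = den/s gives r·t^p =
    -- b.
    have hM0 : r.num.natAbs * r.den ^ (p - 1) ≠ 0 :=
      mul_ne_zero (Int.natAbs_ne_zero.2 (Rat.num_pos.2 hr).ne') (pow_ne_zero _ r.den_nz)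
    obtain ⟨b, s, hbs, hb0, hs0, hbp⟩ := exists_eq_mul_pow_of_ne_zero hp.pos _ hM0
    have hs0' : (s : ℚ) ≠ 0 := by exact_mod_cast hs0
    set t : ℚˣ := Units.mk0 ((r.den : ℚ) / s) (div_ne_zero hn0 hs0') with ht
    have hpos : 0 ≤ (r.den : ℚ) / s := by positivity
    have hnormJ : (normHom (J * ratIdeal t) : ℚ) = b := by
      rw [map_mul, Units.val_mul, coe_normHom_ratIdeal, hdeg, ht, Units.val_mk0,
        abs_of_nonneg hpos, ← hrdef, div_pow, ← mul_div_assoc, div_eq_iff (pow_ne_zero _ hs0')]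
      have h1 : (r.num.natAbs : ℚ) * (r.den : ℚ) ^ (p - 1) = b * (s : ℚ) ^ p := by
        exact_mod_cast hbs
      have h2 : r * r.den = r.num := Rat.mul_den_eq_num r
      rw [← h1, hnum, ← h2, mul_assoc, ← pow_succ', Nat.sub_add_cancel hp.one_le]
    have hfix : J * ratIdeal t ∈ fixedIdeals σ := mul_mem hJ.1 (idealAct_ratIdeal σ t)
    have hbT : b ∈ T := by
      refine ⟨Int.natCast_dvd.2 ((Nat.factorization_prime_le_iff_dvd hb0 hD0').1 ?_), ?_⟩
      -- At an unramified q, the exponent in b is a multiple of p below p, hence 0; at a ramified q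
      -- it is at most p-1.
      · intro q hq
        rw [hD q hq]
        split_ifs with hqd
        · have := hbp q hq
          omega
        · exact (Nat.eq_zero_of_dvd_of_lt (dvd_factorization_of_mem_fixedIdeals hp hdeg hσ hfix hb0
            hnormJ hq hqd) (hbp q hq)).le
      · obtain ⟨α, hα⟩ : normHom (J * ratIdeal t) ∈ (unitsNorm : Kˣ →* ℚˣ).range := by
          rw [map_mul]
          exact mul_mem hJ.2 (normHom_toPrincipalIdeal_mem hp hp2 hdeg _)
        exact ⟨α, hnormJ.symm.trans (congrArg Units.val hα).symm⟩
    refine ⟨⟨b, hbT⟩, QuotientGroup.eq.2 ?_⟩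
    have hfb : (f ⟨b, hbT⟩ : (FractionalIdeal (𝓞 K)⁰ K)ˣ) = J * ratIdeal t :=
      eq_of_normHom_eq hp hdeg hσ (f ⟨b, hbT⟩).2.1 hfix
        (Units.ext ((hf ⟨b, hbT⟩).trans hnormJ.symm))
    refine ⟨t⁻¹, ?_⟩
    change ratIdeal t⁻¹ = (f ⟨b, hbT⟩ : (FractionalIdeal (𝓞 K)⁰ K)ˣ)⁻¹ * J
    rw [hfb, map_inv, mul_inv_rev, inv_mul_cancel_right]

end Cyclic

/-! ### The different and discriminant at a totally ramified prime -/

lemma mem_pow_and_notMem_iff_emultiplicity_eq {P : Ideal (𝓞 K)} {x : 𝓞 K} {n : ℕ} :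
    x ∈ P ^ n ∧ x ∉ P ^ (n + 1) ↔ emultiplicity P (Ideal.span {x}) = n := by
  rw [emultiplicity_eq_coe, Ideal.dvd_span_singleton, Ideal.dvd_span_singleton]

lemma emultiplicity_span_mul {P : Ideal (𝓞 K)} (hP : Prime P) (x y : 𝓞 K) :
    emultiplicity P (Ideal.span {x * y}) =
      emultiplicity P (Ideal.span {x}) + emultiplicity P (Ideal.span {y}) := by
  rw [← Ideal.span_singleton_mul_span_singleton, emultiplicity_mul hP]

lemma emultiplicity_span_pow {P : Ideal (𝓞 K)} (hP : Prime P) (x : 𝓞 K) (n : ℕ) :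
    emultiplicity P (Ideal.span {x ^ n}) = n * emultiplicity P (Ideal.span {x}) := by
  rw [← Ideal.span_singleton_pow, emultiplicity_pow hP]

section TotallyRamified

variable {p q : ℕ} (hq : q.Prime) {P : Ideal (𝓞 K)} [hP : P.IsPrime]
  [hl : P.LiesOver (Ideal.span {(q : ℤ)})] (he : P.ramificationIdx ℤ = p)
  (hPq : P ^ p = Ideal.span {(q : 𝓞 K)}) {π : 𝓞 K} (hπ : π ∈ P) (hπ2 : π ∉ P ^ 2)

include hq hl in
lemma prime_of_liesOver : Prime P := by
  have hq0 : Ideal.span {(q : ℤ)} ≠ ⊥ := by simpa using hq.ne_zero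
  exact (Ideal.prime_iff_isPrime (Ideal.ne_bot_of_liesOver_of_ne_bot hq0 P)).2 hP

include hPq in
omit [NumberField K] hP hl in
lemma intCast_mem_pow {c : ℤ} {k : ℕ} (h : (q : ℤ) ^ k ∣ c) : (c : 𝓞 K) ∈ P ^ (p * k) := by
  obtain ⟨d, rfl⟩ := h
  rw [pow_mul, hPq, Ideal.span_singleton_pow]
  push_cast
  exact Ideal.mul_mem_right _ _ (Ideal.mem_span_singleton_self _)

include hq he hPq hπ hπ2

/-- The valuation of a polynomial expression in a uniformizer of a totally ramified prime is
governed by the first coefficient of least valuation. -/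
lemma emultiplicity_sum_eq {c : ℕ → ℤ} {N k i₀ : ℕ} (hi₀ : i₀ < p) (hi₀N : i₀ < N)
    (hk : ∀ i < N, (q : ℤ) ^ k ∣ c i) (hc : ¬ (q : ℤ) ^ (k + 1) ∣ c i₀)
    (hlt : ∀ i < i₀, (q : ℤ) ^ (k + 1) ∣ c i) :
    emultiplicity P (Ideal.span {∑ i ∈ Finset.range N, (c i : 𝓞 K) * π ^ i}) =
      (p * k + i₀ : ℕ) := by
  have hPp : Prime P := prime_of_liesOver hq
  have h0 : ∀ i ∈ (Finset.range N).erase i₀, (c i : 𝓞 K) * π ^ i ∈ P ^ (p * k + i₀ + 1) := by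
    intro i hi
    obtain ⟨hne, hiN⟩ := Finset.mem_erase.1 hi
    rcases lt_or_gt_of_ne hne with h | h
    -- One extra factor q contributes p > i₀ to the valuation.
    · refine Ideal.mul_mem_right _ _ (Ideal.pow_le_pow_right ?_ (intCast_mem_pow hPq (hlt i h)))
      rw [mul_add, mul_one]
      omega
    · refine Ideal.pow_le_pow_right (show p * k + i₀ + 1 ≤ p * k + i by omega) ?_
      rw [pow_add]
      exact Ideal.mul_mem_mul (intCast_mem_pow hPq (hk i (Finset.mem_range.1 hiN)))
        (Ideal.pow_mem_pow hπ i)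
  have hπv : emultiplicity P (Ideal.span {π}) = (1 : ℕ) :=
    mem_pow_and_notMem_iff_emultiplicity_eq.1 ⟨by rwa [pow_one], hπ2⟩
  have hc0 : c i₀ ≠ 0 := fun h => hc (h ▸ dvd_zero _)
  have hcq : emultiplicity (q : ℤ) (c i₀) = k := emultiplicity_eq_coe.2 ⟨hk i₀ hi₀N, hc⟩
  have h1 : emultiplicity P (Ideal.span {(c i₀ : 𝓞 K) * π ^ i₀}) = (p * k + i₀ : ℕ) := by
    rw [emultiplicity_span_mul hPp, emultiplicity_span_pow hPp, hπv,
      emultiplicity_span_intCast hq P hc0, he, hcq]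
    push_cast
    rw [mul_one]
  obtain ⟨h2, h3⟩ := mem_pow_and_notMem_iff_emultiplicity_eq.2 h1
  have hsum := Ideal.sum_mem _ h0
  rw [← mem_pow_and_notMem_iff_emultiplicity_eq,
    ← Finset.add_sum_erase _ _ (Finset.mem_range.2 hi₀N)]
  exact ⟨Ideal.add_mem _ h2 (Ideal.pow_le_pow_right (Nat.le_succ _) hsum),
    fun h => h3 ((Ideal.add_mem_iff_left _ hsum).1 h)⟩

/-- Otherwise the first index j with q ∤ c_j would make the valuation of the sum equal to j < p. -/
lemma dvd_of_sum_mem_pow {c : ℕ → ℤ} {N : ℕ}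
    (h : ∑ i ∈ Finset.range N, (c i : 𝓞 K) * π ^ i ∈ P ^ p) {i : ℕ} (hiN : i < N) (hip : i < p) :
    (q : ℤ) ∣ c i := by
  classical
  by_contra hi
  have hex : ∃ i, ¬ (q : ℤ) ∣ c i := ⟨i, hi⟩
  have hle : Nat.find hex ≤ i := Nat.find_min' hex hi
  have hv := emultiplicity_sum_eq hq he hPq hπ hπ2 (c := c) (N := N) (k := 0)
    (hle.trans_lt hip) (hle.trans_lt hiN) (fun _ _ => by simp)
    (by simpa using Nat.find_spec hex)
    (fun j hj => by simpa using Nat.find_min hex hj)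
  have h2 := (mem_pow_and_notMem_iff_emultiplicity_eq.2 hv).2
  exact h2 (Ideal.pow_le_pow_right (by omega) h)

variable (hdeg : Module.finrank ℚ K = p)
include hdeg

/-- In degree less than p, the relation f(π) = 0 would force q to divide the leading coefficient 1.
-/
lemma natDegree_minpoly_uniformizer : (minpoly ℤ π).natDegree = p := by
  have hint : IsIntegral ℤ π := Algebra.IsIntegral.isIntegral π
  refine le_antisymm ?_ ?_
  · rw [← hdeg, ← NumberField.RingOfIntegers.rank]
    exact minpoly.natDegree_le π
  · by_contra! hlt
    have h0 := minpoly.aeval ℤ π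
    rw [Polynomial.aeval_eq_sum_range] at h0
    simp_rw [zsmul_eq_mul] at h0
    have h1 := dvd_of_sum_mem_pow hq he hPq hπ hπ2 (h0 ▸ zero_mem _) (Nat.lt_succ_self _) hlt
    rw [Polynomial.coeff_natDegree, minpoly.monic hint] at h1
    exact (Nat.prime_iff_prime_int.1 hq).not_dvd_one h1

lemma dvd_coeff_minpoly_uniformizer {i : ℕ} (hi : i < p) : (q : ℤ) ∣ (minpoly ℤ π).coeff i := by
  have hnat := natDegree_minpoly_uniformizer hq he hPq hπ hπ2 hdeg
  have h0 := minpoly.aeval ℤ π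
  rw [Polynomial.aeval_eq_sum_range] at h0
  simp_rw [zsmul_eq_mul] at h0
  exact dvd_of_sum_mem_pow hq he hPq hπ hπ2 (h0 ▸ zero_mem _) (by omega) hi

lemma adjoin_uniformizer_eq_top : Algebra.adjoin ℚ {algebraMap (𝓞 K) K π} = ⊤ := by
  have hint : IsIntegral ℤ π := Algebra.IsIntegral.isIntegral π
  have h1 : (minpoly ℚ (algebraMap (𝓞 K) K π)).natDegree = Module.finrank ℚ K := by
    rw [minpoly.isIntegrallyClosed_eq_field_fractions ℚ K hint,
      (minpoly.monic hint).natDegree_map, natDegree_minpoly_uniformizer hq he hPq hπ hπ2 hdeg, hdeg]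
  have h2 := (Field.primitive_element_iff_minpoly_natDegree_eq ℚ (algebraMap (𝓞 K) K π)).2 h1
  rw [← IntermediateField.adjoin_simple_toSubalgebra_of_isAlgebraic
    (Algebra.IsAlgebraic.isAlgebraic _), h2, IntermediateField.top_toSubalgebra]

lemma aeval_derivative_eq_sum :
    Polynomial.aeval π (Polynomial.derivative (minpoly ℤ π)) =
      ∑ i ∈ Finset.range p, (((minpoly ℤ π).coeff (i + 1) * (i + 1 : ℕ) : ℤ) : 𝓞 K) * π ^ i := by
  have hnat := natDegree_minpoly_uniformizer hq he hPq hπ hπ2 hdeg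
  have hp0 : (minpoly ℤ π).natDegree ≠ 0 :=
    (minpoly.natDegree_pos (Algebra.IsIntegral.isIntegral π)).ne'
  rw [Polynomial.aeval_eq_sum_range' (n := p)
    ((Polynomial.natDegree_derivative_lt hp0).trans_eq hnat)]
  refine Finset.sum_congr rfl fun i _ => ?_
  rw [Polynomial.coeff_derivative, zsmul_eq_mul]
  push_cast
  rfl

/-- By the Eisenstein property every coefficient of f' is divisible by q except the top one, p. -/
lemma emultiplicity_aeval_derivative_of_ne (hqp : ¬ q ∣ p) :
    emultiplicity P (Ideal.span {Polynomial.aeval π (Polynomial.derivative (minpoly ℤ π))}) =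
      (p - 1 : ℕ) := by
  have hnat := natDegree_minpoly_uniformizer hq he hPq hπ hπ2 hdeg
  have hint : IsIntegral ℤ π := Algebra.IsIntegral.isIntegral π
  have hp0 : 0 < p := hnat ▸ minpoly.natDegree_pos hint
  rw [aeval_derivative_eq_sum hq he hPq hπ hπ2 hdeg]
  have h := emultiplicity_sum_eq hq he hPq hπ hπ2 (N := p) (k := 0) (i₀ := p - 1)
    (c := fun i => (minpoly ℤ π).coeff (i + 1) * (i + 1 : ℕ)) (by omega) (by omega)
    (fun _ _ => by simp) ?_ ?_
  · rw [h, mul_zero, zero_add]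
  · have h1 : (minpoly ℤ π).coeff p = 1 := by
      conv_lhs => rw [← hnat]
      exact minpoly.monic hint
    rw [zero_add, pow_one, Nat.sub_add_cancel hp0, h1, one_mul]
    exact_mod_cast hqp
  · intro i hi
    rw [zero_add, pow_one]
    exact (dvd_coeff_minpoly_uniformizer hq he hPq hπ hπ2 hdeg (by omega)).mul_right _

/-- Every coefficient of f' is divisible by p, while the top one, p, is not divisible by p²; i is
the first index where p² fails to divide. -/
lemma emultiplicity_aeval_derivative_of_eq (hqp : q = p) : ∃ i < p,
    emultiplicity P (Ideal.span {Polynomial.aeval π (Polynomial.derivative (minpoly ℤ π))}) =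
      (p + i : ℕ) := by
  classical
  have hnat := natDegree_minpoly_uniformizer hq he hPq hπ hπ2 hdeg
  have hint : IsIntegral ℤ π := Algebra.IsIntegral.isIntegral π
  have hp0 : 0 < p := hnat ▸ minpoly.natDegree_pos hint
  have h1 : (minpoly ℤ π).coeff p = 1 := by
    conv_lhs => rw [← hnat]
    exact minpoly.monic hint
  rw [aeval_derivative_eq_sum hq he hPq hπ hπ2 hdeg]
  have hlast : ¬ (q : ℤ) ^ (1 + 1) ∣ (minpoly ℤ π).coeff (p - 1 + 1) * (p - 1 + 1 : ℕ) := by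
    rw [Nat.sub_add_cancel hp0, h1, one_mul, hqp, ← Nat.cast_pow, Int.natCast_dvd_natCast]
    intro h
    have := Nat.le_of_dvd hp0 h
    have h2 := (hqp ▸ hq).two_le
    rw [pow_succ, pow_one] at this
    nlinarith
  have hex : ∃ i, ¬ (q : ℤ) ^ (1 + 1) ∣ (minpoly ℤ π).coeff (i + 1) * (i + 1 : ℕ) := ⟨_, hlast⟩
  have hle : Nat.find hex ≤ p - 1 := Nat.find_min' hex hlast
  refine ⟨Nat.find hex, by omega, ?_⟩
  have h := emultiplicity_sum_eq hq he hPq hπ hπ2 (N := p) (k := 1) (i₀ := Nat.find hex)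
    (c := fun i => (minpoly ℤ π).coeff (i + 1) * (i + 1 : ℕ)) (by omega) (by omega)
    ?_ (Nat.find_spec hex) (fun j hj => not_not.1 (Nat.find_min hex hj))
  · rw [h, mul_one]
  · intro i hi
    rw [pow_one]
    rcases Nat.lt_or_ge (i + 1) p with h2 | h2
    · exact (dvd_coeff_minpoly_uniformizer hq he hPq hπ hπ2 hdeg h2).mul_right _
    · have h3 : i + 1 = q := by omega
      rw [h3]
      exact dvd_mul_left _ _

/-- Written as a polynomial in π of degree below p, qz lies in (q) = P^p, so its coefficients are
divisible by q and can be divided. -/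
lemma mem_adjoin_of_natCast_mul_mem {z : 𝓞 K} (hz : (q : 𝓞 K) * z ∈ Algebra.adjoin ℤ {π}) :
    z ∈ Algebra.adjoin ℤ {π} := by
  have hnat := natDegree_minpoly_uniformizer hq he hPq hπ hπ2 hdeg
  have hint : IsIntegral ℤ π := Algebra.IsIntegral.isIntegral π
  rw [Algebra.adjoin_singleton_eq_range_aeval] at hz
  obtain ⟨g, hg⟩ := hz
  have hg' : Polynomial.aeval π (g %ₘ minpoly ℤ π) = (q : 𝓞 K) * z :=
    (Polynomial.aeval_modByMonic_eq_self_of_root (minpoly.aeval ℤ π)).trans hg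
  have hdegree : (g %ₘ minpoly ℤ π).natDegree < p := by
    have := Polynomial.natDegree_modByMonic_lt g (minpoly.monic hint) (minpoly.ne_one ℤ π)
    omega
  rw [Polynomial.aeval_eq_sum_range' hdegree] at hg'
  simp_rw [zsmul_eq_mul] at hg'
  have hdvd : ∀ i < p, (q : ℤ) ∣ (g %ₘ minpoly ℤ π).coeff i := fun i hi =>
    dvd_of_sum_mem_pow hq he hPq hπ hπ2 (by
      rw [hg', hPq]
      exact Ideal.mul_mem_right _ _ (Ideal.mem_span_singleton_self _)) hi hi
  choose! d hd using hdvd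
  have hz' : z = ∑ i ∈ Finset.range p, (d i : 𝓞 K) * π ^ i := by
    apply mul_left_cancel₀ (show (q : 𝓞 K) ≠ 0 by exact_mod_cast hq.ne_zero)
    rw [← hg', Finset.mul_sum]
    refine Finset.sum_congr rfl fun i hi => ?_
    rw [hd i (Finset.mem_range.1 hi)]
    push_cast
    ring
  rw [hz']
  exact sum_mem fun i _ => mul_mem (intCast_mem _ _)
    (pow_mem (Algebra.self_mem_adjoin_singleton ℤ π) i)

lemma mem_conductor_of_natCast_mul_mem {z : 𝓞 K} (hz : (q : 𝓞 K) * z ∈ conductor ℤ π) :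
    z ∈ conductor ℤ π := by
  rw [mem_conductor_iff] at hz ⊢
  exact fun b => mem_adjoin_of_natCast_mul_mem hq he hPq hπ hπ2 hdeg (mul_assoc (q : 𝓞 K) z b ▸ hz b)

/-- The conductor contains its norm, and factors q can be cancelled from that integer. What remains
is prime to q, hence outside P. -/
lemma conductor_not_le (h0 : conductor ℤ π ≠ ⊥) : ¬ conductor ℤ π ≤ P := by
  intro hle
  have hm := Ideal.absNorm_mem (conductor ℤ π)
  have hm0 : Ideal.absNorm (conductor ℤ π) ≠ 0 := by rwa [Ne, Ideal.absNorm_eq_zero_iff]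
  obtain ⟨k, m, hqm, hkm⟩ := Nat.exists_eq_pow_mul_and_not_dvd hm0 q hq.ne_one
  have hmem : (m : 𝓞 K) ∈ conductor ℤ π := by
    rw [hkm] at hm
    clear hkm
    induction k with
    | zero => simpa using hm
    | succ k ih =>
      refine ih (mem_conductor_of_natCast_mul_mem hq he hPq hπ hπ2 hdeg ?_)
      rwa [pow_succ', mul_assoc, Nat.cast_mul] at hm
  have h1 : (m : ℤ) ∈ P.under ℤ := by
    rw [Ideal.under_def, Ideal.mem_comap]
    simpa using hle hmem
  rw [← hl.over, Ideal.mem_span_singleton, Int.natCast_dvd_natCast] at h1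
  exact hqm h1

lemma emultiplicity_differentIdeal {n : ℕ}
    (hn : emultiplicity P (Ideal.span {Polynomial.aeval π (Polynomial.derivative (minpoly ℤ π))}) =
      n) : emultiplicity P (differentIdeal ℤ (𝓞 K)) = n := by
  have hmul := conductor_mul_differentIdeal ℤ ℚ K π
    (adjoin_uniformizer_eq_top hq he hPq hπ hπ2 hdeg)
  have hc : conductor ℤ π ≠ ⊥ := by
    intro h
    rw [h, Ideal.bot_mul] at hmul
    rw [← hmul, ← Ideal.zero_eq_bot, emultiplicity_zero] at hn
    exact ENat.top_ne_natCast _ hn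
  rw [← hmul, emultiplicity_mul (prime_of_liesOver hq), emultiplicity_eq_zero.2, zero_add] at hn
  · exact hn
  · exact fun h => conductor_not_le hq he hPq hπ hπ2 hdeg hc (Ideal.le_of_dvd h)

end TotallyRamified

/-- |d_K| is the norm of the different, and P is the only prime above q, so the part of the
different prime to P has norm prime to q. -/
lemma factorization_natAbs_discr {q : ℕ} (hq : q.Prime) {P : Ideal (𝓞 K)} [hP : P.IsPrime]
    {p n : ℕ} [P.LiesOver (Ideal.span {(q : ℤ)})] (hPq : P ^ p = Ideal.span {(q : 𝓞 K)})
    (hN : Ideal.absNorm P = q) (hn : emultiplicity P (differentIdeal ℤ (𝓞 K)) = n) :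
    (NumberField.discr K).natAbs.factorization q = n := by
  obtain ⟨⟨J, hJ⟩, h2⟩ := emultiplicity_eq_coe.1 hn
  have hqJ : ¬ q ∣ Ideal.absNorm J := by
    intro h
    obtain ⟨Q, hQ, hQq, hQJ⟩ := Ideal.exists_isMaximal_dvd_of_dvd_absNorm' hq J h
    have hqQ : (q : 𝓞 K) ∈ Q := by
      have h3 : (q : ℤ) ∈ Q.under ℤ := hQq ▸ Ideal.mem_span_singleton_self _
      simpa [Ideal.under_def] using h3
    have hle : P ^ p ≤ Q := hPq ▸ (Ideal.span_singleton_le_iff_mem Q).2 hqQ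
    have hPQ : P ≤ Q := hQ.isPrime.le_of_pow_le hle
    have hPmax : P.IsMaximal := hP.isMaximal (prime_of_liesOver hq).ne_zero
    rw [← hPmax.eq_of_le hQ.ne_top hPQ] at hQJ
    exact h2 (hJ ▸ pow_succ P n ▸ mul_dvd_mul_left _ hQJ)
  have hJ0 : Ideal.absNorm J ≠ 0 := fun h => hqJ (by rw [h]; exact dvd_zero q)
  rw [← NumberField.absNorm_differentIdeal K (𝓞 K), hJ, map_mul, map_pow, hN,
    Nat.factorization_mul (pow_ne_zero _ hq.ne_zero) hJ0,
    hq.factorization_pow, Finsupp.add_apply, Finsupp.single_eq_same,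
    Nat.factorization_eq_zero_of_not_dvd hqJ, add_zero]

open Polynomial in
lemma map_minpoly_eq_prod [IsGalois ℚ K] {x : 𝓞 K}
    (hx : (minpoly ℤ x).natDegree = Module.finrank ℚ K) :
    (minpoly ℤ x).map (algebraMap ℤ (𝓞 K)) = ∏ τ : K ≃ₐ[ℚ] K, (X - C (τ • x)) := by
  have := IsGaloisGroup.of_isFractionRing (K ≃ₐ[ℚ] K) ℤ (𝓞 K) ℚ K
  have := this.isInvariant
  obtain ⟨f, hf, hdegf, hmonic⟩ := Polynomial.lifts_and_natDegree_eq_and_monic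
    (Algebra.IsInvariant.charpoly_mem_lifts ℤ (𝓞 K) (K ≃ₐ[ℚ] K) x)
    (MulSemiringAction.monic_charpoly _ _)
  have hroot : aeval x f = 0 := by
    rw [aeval_def, ← eval_map, hf, MulSemiringAction.eval_charpoly]
  have hint : IsIntegral ℤ x := Algebra.IsIntegral.isIntegral x
  have hfd : f.natDegree = Module.finrank ℚ K := by
    rw [hdegf, MulSemiringAction.charpoly_eq, natDegree_finsetProd_X_sub_C_eq_card,
      Finset.card_univ, ← Nat.card_eq_fintype_card, IsGalois.card_aut_eq_finrank]
  have heq : minpoly ℤ x = f := by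
    refine (eq_of_monic_of_dvd_of_natDegree_le (minpoly.monic hint) hmonic
      (minpoly.isIntegrallyClosed_dvd hint hroot) (hfd.trans hx.symm).le).symm
  rw [heq, hf, MulSemiringAction.charpoly_eq]

open Polynomial Classical in
lemma aeval_derivative_minpoly_eq_prod [IsGalois ℚ K] {x : 𝓞 K}
    (hx : (minpoly ℤ x).natDegree = Module.finrank ℚ K) :
    aeval x (derivative (minpoly ℤ x)) =
      ∏ τ ∈ (Finset.univ : Finset (K ≃ₐ[ℚ] K)).erase 1, (x - τ • x) := by
  have h := Lagrange.eval_nodal_derivative_eval_node_eq (v := fun τ : K ≃ₐ[ℚ] K => τ • x)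
    (Finset.mem_univ 1)
  rw [Lagrange.nodal, ← map_minpoly_eq_prod hx, derivative_map, Lagrange.eval_nodal, one_smul,
    eval_map_algebraMap] at h
  exact h

open scoped Pointwise in
lemma sub_smul_mem_of_mem_zpowers {σ τ : K ≃ₐ[ℚ] K} (hτ : τ ∈ Subgroup.zpowers σ)
    {I : Ideal (𝓞 K)} (hI : σ • I = I) {x : 𝓞 K} (hx : x - σ • x ∈ I) : x - τ • x ∈ I := by
  obtain ⟨k, rfl⟩ := mem_powers_iff_mem_zpowers.2 hτ
  dsimp only
  induction k with
  | zero => simp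
  | succ k ih =>
    have h : x - σ ^ (k + 1) • x = (x - σ • x) + σ • (x - σ ^ k • x) := by
      rw [smul_sub, ← mul_smul, ← pow_succ']
      ring
    rw [h]
    refine Ideal.add_mem _ hx ?_
    have h1 := (Ideal.smul_mem_pointwise_smul_iff (a := σ)).2 (ih ⟨k, by simp⟩)
    rwa [hI] at h1

open scoped Pointwise in
open Classical in
/-- In a cyclic extension of prime degree, the valuation of `x - τ x` at a totally ramified prime
does not depend on `τ ≠ 1`, so that the valuation of the different of `x` is a multiple of
`p - 1`. -/
lemma exists_emultiplicity_prod_sub_smul [IsGalois ℚ K] {p : ℕ} (hp : p.Prime)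
    (hdeg : Module.finrank ℚ K = p) {P : Ideal (𝓞 K)} (hP : Prime P)
    (hPs : ∀ τ : K ≃ₐ[ℚ] K, τ • P = P) (x : 𝓞 K) :
    ∃ m : ℕ∞, emultiplicity P (Ideal.span
      {∏ τ ∈ (Finset.univ : Finset (K ≃ₐ[ℚ] K)).erase 1, (x - τ • x)}) = (p - 1 : ℕ) * m := by
  have hcard : Nat.card (K ≃ₐ[ℚ] K) = p := (IsGalois.card_aut_eq_finrank ℚ K).trans hdeg
  have : Fact p.Prime := ⟨hp⟩
  have hPn : ∀ (τ : K ≃ₐ[ℚ] K) (n : ℕ), τ • P ^ n = P ^ n := fun τ n => by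
    rw [smul_pow', hPs]
  have : Nontrivial (K ≃ₐ[ℚ] K) := Finite.one_lt_card_iff_nontrivial.1 (hcard ▸ hp.one_lt)
  obtain ⟨σ, hσ⟩ := exists_ne (1 : K ≃ₐ[ℚ] K)
  refine ⟨emultiplicity P (Ideal.span {x - σ • x}), ?_⟩
  rw [← Ideal.prod_span_singleton, Finset.emultiplicity_prod hP,
    Finset.sum_congr rfl (g := fun _ => emultiplicity P (Ideal.span {x - σ • x})), Finset.sum_const,
    Finset.card_erase_of_mem (Finset.mem_univ _), Finset.card_univ, ← Nat.card_eq_fintype_card,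
    hcard, nsmul_eq_mul]
  intro τ hτ
  refine emultiplicity_eq_emultiplicity_iff.2 fun n => ?_
  rw [Ideal.dvd_span_singleton, Ideal.dvd_span_singleton]
  -- In a group of prime order σ and τ are powers of each other.
  exact ⟨sub_smul_mem_of_mem_zpowers (mem_zpowers_of_prime_card hcard (Finset.ne_of_mem_erase hτ))
    (hPn _ _), sub_smul_mem_of_mem_zpowers (mem_zpowers_of_prime_card hcard hσ) (hPn _ _)⟩

/-- The exponent of a prime in the discriminant of a cyclic number field of odd prime degree. -/
lemma factorization_natAbs_discr_of_dvd [IsGalois ℚ K] {p : ℕ} (hp : p.Prime) (hp2 : p ≠ 2)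
    (hdeg : Module.finrank ℚ K = p) {q : ℕ} (hq : q.Prime) (hqd : (q : ℤ) ∣ NumberField.discr K) :
    (NumberField.discr K).natAbs.factorization q = if q = p then 2 * (p - 1) else p - 1 := by
  obtain ⟨P, hP, hl, hPq, hN, he, hs⟩ := exists_prime_pow_eq_of_dvd_discr hp hdeg hq hqd
  have hPp : Prime P := prime_of_liesOver hq
  obtain ⟨π, hπ, hπ2⟩ : ∃ π ∈ P, π ∉ P ^ 2 := by
    simpa using Ideal.exists_mem_pow_notMem_pow_succ P hPp.ne_zero hP.ne_top 1
  refine factorization_natAbs_discr hq hPq hN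
    (emultiplicity_differentIdeal hq he hPq hπ hπ2 hdeg ?_)
  split_ifs with hqp
  · obtain ⟨i, hi, h⟩ := emultiplicity_aeval_derivative_of_eq hq he hPq hπ hπ2 hdeg hqp
    obtain ⟨m, hm⟩ := exists_emultiplicity_prod_sub_smul hp hdeg hPp hs π
    rw [← aeval_derivative_minpoly_eq_prod
      ((natDegree_minpoly_uniformizer hq he hPq hπ hπ2 hdeg).trans hdeg.symm), h] at hm
    rw [h]
    have h3 : 3 ≤ p := by have := hp.two_le; omega
    have hmt : m ≠ ⊤ := by
      rintro rfl
      rw [ENat.mul_top (by exact_mod_cast (show p - 1 ≠ 0 by omega))] at hm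
      exact ENat.natCast_ne_top _ hm
    lift m to ℕ using hmt
    norm_cast at hm ⊢
    obtain ⟨r, rfl⟩ : ∃ r, p = r + 1 := ⟨p - 1, by omega⟩
    rw [Nat.add_sub_cancel] at hm ⊢
    -- The valuation p + i lies in [p, 2p-1], where 2(p-1) is the only multiple of p-1 since p ≥ 3.
    have hm2 : m = 2 := by
      refine le_antisymm ?_ ?_
      · by_contra! h4
        have := Nat.mul_le_mul_left r (show 3 ≤ m from h4)
        omega
      · by_contra! h4
        have := Nat.mul_le_mul_left r (show m ≤ 1 by omega)
        omega
    rw [hm, hm2, mul_comm]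
  · exact emultiplicity_aeval_derivative_of_ne hq he hPq hπ hπ2 hdeg
      (fun h => hqp ((Nat.prime_dvd_prime_iff_eq hq hp).1 h))

/-! ### The prime factorization of D -/

section NormDisc

variable [IsGalois ℚ K] {p : ℕ} (hp : p.Prime) (hp2 : p ≠ 2) (hdeg : Module.finrank ℚ K = p)
include hp hp2 hdeg

lemma discr_eq_mul_normDisc (hpd : (p : ℤ) ∣ NumberField.discr K) :
    NumberField.discr K = (p : ℤ) ^ (p - 1) * normDisc p K := by
  have h := factorization_natAbs_discr_of_dvd hp hp2 hdeg hp hpd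
  rw [if_pos rfl] at h
  have h1 : (p : ℤ) ^ (p - 1) ∣ NumberField.discr K := by
    rw [← Nat.cast_pow, Int.natCast_dvd, hp.pow_dvd_iff_le_factorization
      (Int.natAbs_ne_zero.2 (NumberField.discr_ne_zero K)), h]
    omega
  rw [normDisc, if_pos hpd, Int.mul_ediv_cancel' h1]

lemma normDisc_ne_zero : normDisc p K ≠ 0 := by
  by_cases hpd : (p : ℤ) ∣ NumberField.discr K
  · exact right_ne_zero_of_mul
      (discr_eq_mul_normDisc hp hp2 hdeg hpd ▸ NumberField.discr_ne_zero K)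
  · rw [normDisc, if_neg hpd]
    exact NumberField.discr_ne_zero K

/-- Dividing by p^(p-1) lowers the wild exponent 2(p-1) to the tame value p-1. -/
lemma factorization_natAbs_normDisc {q : ℕ} (hq : q.Prime) :
    (normDisc p K).natAbs.factorization q =
      if (q : ℤ) ∣ NumberField.discr K then p - 1 else 0 := by
  have hD : (NumberField.discr K).natAbs.factorization q =
      if (q : ℤ) ∣ NumberField.discr K then if q = p then 2 * (p - 1) else p - 1 else 0 := by
    split_ifs with hqd hqp
    · rw [factorization_natAbs_discr_of_dvd hp hp2 hdeg hq hqd, if_pos hqp]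
    · rw [factorization_natAbs_discr_of_dvd hp hp2 hdeg hq hqd, if_neg hqp]
    · exact Nat.factorization_eq_zero_of_not_dvd fun h => hqd (Int.natCast_dvd.2 h)
  by_cases hpd : (p : ℤ) ∣ NumberField.discr K
  · have h := discr_eq_mul_normDisc hp hp2 hdeg hpd
    have h1 : (NumberField.discr K).natAbs = p ^ (p - 1) * (normDisc p K).natAbs := by
      conv_lhs => rw [h]
      rw [Int.natAbs_mul, Int.natAbs_pow, Int.natAbs_natCast]
    rw [h1, Nat.factorization_mul (pow_ne_zero _ hp.ne_zero)
      (Int.natAbs_ne_zero.2 (normDisc_ne_zero hp hp2 hdeg)), hp.factorization_pow,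
      Finsupp.add_apply] at hD
    by_cases hqp : q = p
    · subst hqp
      rw [Finsupp.single_eq_same, if_pos hpd, if_pos rfl] at hD
      rw [if_pos hpd]
      omega
    · rw [Finsupp.single_eq_of_ne hqp, zero_add] at hD
      simpa [hqp] using hD
  · rw [normDisc, if_neg hpd, hD]
    split_ifs with hqd hqp
    · exact absurd (hqp ▸ hqd) hpd
    · rfl
    · rfl

end NormDisc

end CyclicDegP

theorem mainTheorem8 (p : ℕ) (hp : p.Prime) (hp2 : p ≠ 2)
    (K : Type*) [Field K] [NumberField K] [IsGalois ℚ K]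
    (hdeg : Module.finrank ℚ K = p)
    (σ : K ≃ₐ[ℚ] K) (hσ : ∀ τ : K ≃ₐ[ℚ] K, τ ∈ Subgroup.zpowers σ) :
    (∀ I : (FractionalIdeal (𝓞 K)⁰ K)ˣ,
      CyclicDegP.classAct σ (ClassGroup.mk K I) = ClassGroup.mk K I →
        (ClassGroup.mk K I ∈ CyclicDegP.imPhi p σ ↔
          ∃ α : K, FractionalIdeal.absNorm (I : FractionalIdeal (𝓞 K)⁰ K) = Algebra.norm ℚ α)) ∧
    (Nat.card (CyclicDegP.imPhi p σ) : ℚ) =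
      1 / (p : ℚ) *
        (Set.ncard {b : ℕ | (b : ℤ) ∣ CyclicDegP.normDisc p K ∧
          ∃ α : Kˣ, (b : ℚ) = Algebra.norm ℚ (α : K)} : ℚ) := by
  refine ⟨fun I hI => (CyclicDegP.mk_mem_imPhi_iff hp hp2 hdeg hσ hI).trans ⟨?_, ?_⟩, ?_⟩
  · rintro ⟨x, hx⟩
    exact ⟨x, hx⟩
  · rintro ⟨α, hα⟩
    -- The value α = 0 is excluded because a nonzero ideal has positive norm.
    have hα0 : α ≠ 0 := by
      rintro rfl
      rw [Algebra.norm_zero] at hα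
      exact (CyclicDegP.normHom_pos I).ne' hα
    exact ⟨Units.mk0 α hα0, hα⟩
  · rw [CyclicDegP.ncard_eq_relIndex hp hp2 hdeg hσ (CyclicDegP.normDisc_ne_zero hp hp2 hdeg)
      (fun q => CyclicDegP.factorization_natAbs_normDisc hp hp2 hdeg),
      CyclicDegP.relIndex_ratIdeal_fixedNormIdeals hp hp2 hdeg hσ, Nat.cast_mul, one_div,
      inv_mul_cancel_left₀ (Nat.cast_ne_zero.2 hp.ne_zero)]
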